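/- Let $1\le k\le n$, let $\mathcal O=\mathbf C\{x_1,\dots,x_n\}$ be the ring of convergent power series and $\mathcal D=\mathcal O[\partial_1,\dots,\partial_n]$ the ring of germs at $0\in\mathbf C^n$ of linear differential operators with holomorphic coefficients. Write $P=\sum p_{\alpha\beta}x^\alpha\partial^\beta$ for $P\in\mathcal D$. For $s\in\mathbf Z^k$ let $$V_s(\mathcal D)=\{P : \beta_i-\alpha_i\le s_i \text{ for } i=1,\dots,k \text{ whenever } p_{\alpha\beta}\ne0\}$$ be the $V$-multifiltration along the transverse hypersurfaces $x_1=0,\dots,x_k=0$. Let $r\ge 0$, let $N\subset\mathcal D^r$ be a left submodule, let $M=\mathcal D^r/N$, and let $m=(m^{(1)},\dots,m^{(r)})\in(\mathbf Z^k)^r$ be a shift. Endow $M$ with the good multifiltration $U_s(M)=(V[m]_s(\mathcal D^r)+N)/N$, where $V[m]_s(\mathcal D^r)=\bigoplus_j V_{s-m^{(j)}}(\mathcal D)$. *The analytic standard fan.* Let $\mathcal D[t]$ be the homogenization of $\mathcal D$, in which $t$ is central and $[\partial_i,a]=\frac{\partial a}{\partial x_i}t$ for $a\in\mathcal O$; it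 is the Rees ring of the filtration of $\mathcal D$ by the order of operators. Let $h(N)\subset\mathcal D[t]^r$ be the left submodule generated by the homogenizations of the elements of $N$; the homogenization of $(P_1,\dots,P_r)$, with $P_j=\sum_\beta p_{j,\beta}(x)\partial^\beta$, is the vector with entries $\sum_\beta p_{j,\beta}(x)\,\partial^\beta t^{d-|\beta|}$, where $d$ is the maximum of the orders of the $P_j$. For a linear form $L$ on $\mathbf Q^k$ with non-negative coefficients, give the monomial $x^\alpha\partial^\beta t^\ell\varepsilon_j$ of $\mathcal D[t]^r$ (where $\varepsilon_j$ is the $j$-th basis vector) the $L$-degree $L(\beta-\alpha+m^{(j)})$, using only the first $k$ coordinates of $\alpha,\beta$. Let $\mathrm{gr}^L(h(N))$ be the graded module generated by the $L$-symbols (the parts of highest $L$-degree) of the elements of $h(N)$. The cones of the analytic standard fan of $h(N)$ are the closures of the classes of the partition of the set $(\mathbf Q^k)^*_+$ of linear forms with non-negative coefficients according to the value of $\mathrm{gr}^L(h(N))$. *The Rees module.* Let $\Gamma\subset(\mathbf Q^k)^*_+$ be a basic cone, that is, a cone generated by linear forms $L_1,\dots,L_k$ with non-negative integer coefficients which form a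 basis of the lattice $\mathbf Z^k$ of integral forms. Let $\check\Gamma=\{a\in\mathbf Q^k : \gamma(a)\ge0 \text{ for all } \gamma\in\Gamma\}$ be its dual cone and $A_\Gamma=\mathbf C[\check\Gamma\cap\mathbf Z^k]\subset\mathbf C[u_1^{\pm1},\dots,u_k^{\pm1}]$. Put $$U^\Gamma_s(M)=\sum_{\sigma\in\mathbf Z^k,\ L_i(\sigma)\le L_i(s)\ \forall i}U_\sigma(M),\qquad \mathcal R^\Gamma(M)=\bigoplus_{s\in\mathbf Z^k}U^\Gamma_s(M)\,u^s\subset M[u_1^{\pm1},\dots,u_k^{\pm1}].$$ **Theorem.** If $\Gamma$ is contained in a cone of the analytic standard fan of $h(N)$, then $\mathcal R^\Gamma(M)$ is flat over $A_\Gamma$. Here $A_\Gamma=\mathbf C[W_1,\dots,W_k]$ is a polynomial ring in the variables $W_j=u^{C_j}$, where $C_1,\dots,C_k\in\mathbf Z^k$ is the basis dual to $L_1,\dots,L_k$. -/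

import Mathlib

open scoped TensorProduct

noncomputable section

namespace StdFan

/-! ### Convergent power series and differential operators -/

theorem summable_antidiagonal {n : ℕ} {F G : (Fin n →₀ ℕ) → ℝ} (hF : Summable F) (hG : Summable G)
    (h1 : ∀ α, 0 ≤ F α) (h2 : ∀ α, 0 ≤ G α) :
    Summable fun α => ∑ p ∈ Finset.HasAntidiagonal.antidiagonal α, F p.1 * G p.2 :=
    summable_sum_mul_antidiagonal_of_summable_mul (hF.mul_of_nonneg hG h1 h2)

theorem convergent_mul {n : ℕ} {f g : MvPowerSeries (Fin n) ℂ}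
    (hf : ∃ ρ : ℝ, 0 < ρ ∧ Summable fun α : Fin n →₀ ℕ => ‖MvPowerSeries.coeff α f‖ * ρ ^ α.degree)
    (hg : ∃ ρ : ℝ, 0 < ρ ∧ Summable fun α : Fin n →₀ ℕ => ‖MvPowerSeries.coeff α g‖ * ρ ^ α.degree) :
    ∃ ρ : ℝ, 0 < ρ ∧
      Summable fun α : Fin n →₀ ℕ => ‖MvPowerSeries.coeff α (f * g)‖ * ρ ^ α.degree := by
  obtain ⟨a, ha, hfa⟩ := hf
  obtain ⟨b, hb, hgb⟩ := hg
  obtain ⟨ρ, hρ, hρa, hρb⟩ : ∃ ρ : ℝ, 0 < ρ ∧ ρ ≤ a ∧ ρ ≤ b :=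
    ⟨min a b, lt_min ha hb, min_le_left _ _, min_le_right _ _⟩
  have hf' : Summable fun α : Fin n →₀ ℕ =>
      ‖MvPowerSeries.coeff α f‖ * ρ ^ α.degree := by
    refine hfa.of_nonneg_of_le (fun α => by positivity) fun α => ?_
    gcongr
  have hg' : Summable fun α : Fin n →₀ ℕ =>
      ‖MvPowerSeries.coeff α g‖ * ρ ^ α.degree := by
    refine hgb.of_nonneg_of_le (fun α => by positivity) fun α => ?_
    gcongr
  refine ⟨ρ, hρ, ?_⟩
  refine (summable_antidiagonal hf' hg' (fun α => by positivity) (fun α => by positivity)).of_nonneg_of_le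
    (fun α => by positivity) fun α => ?_
  rw [MvPowerSeries.coeff_mul]
  refine (mul_le_mul_of_nonneg_right (norm_sum_le _ _) (by positivity)).trans (le_of_eq ?_)
  rw [Finset.sum_mul]
  refine Finset.sum_congr rfl fun p hp => ?_
  have h1 : α.degree = p.1.degree + p.2.degree := by
    rw [← Finset.HasAntidiagonal.mem_antidiagonal.mp hp, map_add]
  rw [h1, pow_add, norm_mul, mul_mul_mul_comm]

theorem convergent_C {n : ℕ} (c : ℂ) :
    ∃ ρ : ℝ, 0 < ρ ∧ Summable fun α : Fin n →₀ ℕ =>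
      ‖MvPowerSeries.coeff α (MvPowerSeries.C (σ := Fin n) c)‖ * ρ ^ α.degree := by
  classical
  refine ⟨1, one_pos, summable_of_ne_finset_zero (s := {0}) fun α hα => ?_⟩
  rw [MvPowerSeries.coeff_C, if_neg (by simpa using hα)]
  simp

/-- The ring `ℂ{x₁,…,xₙ}` of convergent power series: the formal power series which converge
absolutely on some polydisc around the origin. -/
def convergentSeries (n : ℕ) : Subalgebra ℂ (MvPowerSeries (Fin n) ℂ) where
  carrier := {f | ∃ ρ : ℝ, 0 < ρ ∧
    Summable fun α : Fin n →₀ ℕ => ‖MvPowerSeries.coeff α f‖ * ρ ^ α.degree}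
  mul_mem' hf hg := convergent_mul hf hg
  add_mem' := by
    rintro f g ⟨a, ha, hfa⟩ ⟨b, hb, hgb⟩
    refine ⟨min a b, lt_min ha hb, (hfa.add hgb).of_nonneg_of_le
      (fun α => mul_nonneg (norm_nonneg _) (pow_nonneg (lt_min ha hb).le _)) fun α => ?_⟩
    have h0 : 0 ≤ min a b := (lt_min ha hb).le
    rw [map_add]
    calc ‖MvPowerSeries.coeff α f + MvPowerSeries.coeff α g‖ * (min a b) ^ α.degree
        ≤ (‖MvPowerSeries.coeff α f‖ + ‖MvPowerSeries.coeff α g‖) * (min a b) ^ α.degree := by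
          gcongr
          exact norm_add_le _ _
      _ ≤ _ := by
          rw [add_mul]
          gcongr
          · exact min_le_left _ _
          · exact min_le_right _ _
  algebraMap_mem' c := convergent_C c

/-- The ring `ℂ{x₁,…,xₙ}`, as a type. -/
def ConvSeries (n : ℕ) : Type := convergentSeries n

instance (n : ℕ) : CommRing (ConvSeries n) := inferInstanceAs (CommRing (convergentSeries n))

instance (n : ℕ) : Algebra ℂ (ConvSeries n) := inferInstanceAs (Algebra ℂ (convergentSeries n))

/-- The inclusion `ℂ{x} ⊆ ℂ[[x]]`. -/
def ConvSeries.toSeries {n : ℕ} : ConvSeries n →ₐ[ℂ] MvPowerSeries (Fin n) ℂ :=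
  (convergentSeries n).val

theorem ConvSeries.ext {n : ℕ} {f g : ConvSeries n} (h : f.toSeries = g.toSeries) : f = g :=
  Subtype.ext h

/-- A convergent power series as an element of `ℂ{x}`. -/
def ConvSeries.mk {n : ℕ} (f : MvPowerSeries (Fin n) ℂ) (hf : f ∈ convergentSeries n) :
    ConvSeries n :=
  Subtype.mk (p := fun f => f ∈ convergentSeries n) f hf

theorem ConvSeries.toSeries_mk {n : ℕ} (f : MvPowerSeries (Fin n) ℂ)
    (hf : f ∈ convergentSeries n) : (ConvSeries.mk f hf).toSeries = f :=
  rfl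

theorem ConvSeries.toSeries_mem {n : ℕ} (f : ConvSeries n) : f.toSeries ∈ convergentSeries n :=
  Subtype.property f

theorem pderiv_mem {n : ℕ} (i : Fin n) {f : MvPowerSeries (Fin n) ℂ} (hf : f ∈ convergentSeries n) :
    MvPowerSeries.pderiv ℂ i f ∈ convergentSeries n := by
  obtain ⟨a, ha, hfa⟩ := hf
  refine ⟨a / 2, by positivity, ?_⟩
  have hinj : Function.Injective fun α : Fin n →₀ ℕ => α + Finsupp.single i 1 :=
    add_left_injective _
  refine ((hfa.comp_injective hinj).mul_left (1 / a)).of_nonneg_of_le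
    (fun α => by positivity) fun α => ?_
  simp only [Function.comp_apply]
  rw [MvPowerSeries.coeff_pderiv, map_add, Finsupp.degree_single, pow_succ, norm_mul]
  have h1 : ‖((α i : ℂ) + 1)‖ ≤ 2 ^ α.degree := by
    have h2 : α i + 1 ≤ 2 ^ α.degree :=
      (Nat.succ_le_succ (Finsupp.le_degree i α)).trans (Nat.lt_two_pow_self (n := α.degree))
    have h3 : ‖((α i : ℂ) + 1)‖ = ((α i + 1 : ℕ) : ℝ) := by
      rw [← Complex.norm_natCast]
      push_cast
      rfl
    rw [h3]
    exact_mod_cast h2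
  have h4 : 0 < a ^ α.degree := by positivity
  have h5 : (a / 2) ^ α.degree * 2 ^ α.degree = a ^ α.degree := by
    rw [← mul_pow]
    congr 1
    ring
  set u := ‖MvPowerSeries.coeff (α + Finsupp.single i 1) f‖ with hu
  have hu0 : 0 ≤ u := norm_nonneg _
  calc u * ‖((α i : ℂ) + 1)‖ * (a / 2) ^ α.degree
      ≤ u * 2 ^ α.degree * (a / 2) ^ α.degree := by gcongr
    _ = u * a ^ α.degree := by rw [← h5]; ring
    _ = 1 / a * (u * (a ^ α.degree * a)) := by field_simp

/-- Multiplication by a convergent power series, as an operator on `ℂ{x}`. -/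
def mulOp {n : ℕ} (a : ConvSeries n) : Module.End ℂ (ConvSeries n) :=
  LinearMap.mulLeft ℂ a

/-- The partial derivative `∂ᵢ`, as an operator on `ℂ{x}`. -/
def partialOp {n : ℕ} (i : Fin n) : Module.End ℂ (ConvSeries n) where
  toFun f := ConvSeries.mk (MvPowerSeries.pderiv ℂ i f.toSeries) (pderiv_mem i f.toSeries_mem)
  map_add' f g := by
    apply ConvSeries.ext
    simp [ConvSeries.toSeries_mk]
  map_smul' c f := by
    apply ConvSeries.ext
    simp [ConvSeries.toSeries_mk]

theorem toSeries_partialOp {n : ℕ} (i : Fin n) (f : ConvSeries n) :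
    (partialOp i f).toSeries = MvPowerSeries.pderiv ℂ i f.toSeries :=
  rfl

/-- The ring `𝒟` of germs at the origin of `ℂⁿ` of linear differential operators with holomorphic
coefficients: the algebra of operators on `ℂ{x}` generated by `ℂ{x}` and `∂₁,…,∂ₙ`. -/
def diffOps (n : ℕ) : Subalgebra ℂ (Module.End ℂ (ConvSeries n)) :=
  Algebra.adjoin ℂ (Set.range mulOp ∪ Set.range partialOp)

/-- The ring `𝒟`, as a type. -/
def D (n : ℕ) : Type := diffOps n

instance (n : ℕ) : Ring (D n) := inferInstanceAs (Ring (diffOps n))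

instance (n : ℕ) : Algebra ℂ (D n) := inferInstanceAs (Algebra ℂ (diffOps n))

/-- The action of `𝒟` on `ℂ{x}`. -/
def D.toEnd {n : ℕ} : D n →ₐ[ℂ] Module.End ℂ (ConvSeries n) := (diffOps n).val

/-- A convergent power series as an element of `𝒟`. -/
def D.ofSeries {n : ℕ} (a : ConvSeries n) : D n :=
  Subtype.mk (p := fun P => P ∈ diffOps n) (mulOp a) (Algebra.subset_adjoin (Or.inl ⟨a, rfl⟩))

/-- The operator `∂ᵢ` as an element of `𝒟`. -/
def D.partial {n : ℕ} (i : Fin n) : D n :=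
  Subtype.mk (p := fun P => P ∈ diffOps n) (partialOp i)
    (Algebra.subset_adjoin (Or.inr ⟨i, rfl⟩))

theorem partialOp_commute {n : ℕ} (i j : Fin n) :
    Commute (partialOp i : Module.End ℂ (ConvSeries n)) (partialOp j) := by
  rcases eq_or_ne i j with rfl | hij
  · exact Commute.refl _
  refine LinearMap.ext fun f => ConvSeries.ext (MvPowerSeries.ext fun α => ?_)
  change MvPowerSeries.coeff α (MvPowerSeries.pderiv ℂ i (MvPowerSeries.pderiv ℂ j f.toSeries)) =
    MvPowerSeries.coeff α (MvPowerSeries.pderiv ℂ j (MvPowerSeries.pderiv ℂ i f.toSeries))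
  simp only [MvPowerSeries.coeff_pderiv, Finsupp.add_apply, Finsupp.single_eq_of_ne hij,
    Finsupp.single_eq_of_ne hij.symm, add_zero]
  rw [add_right_comm]
  ring

theorem partialOp_pairwise {n : ℕ} (β : Fin n →₀ ℕ) (s : Set (Fin n)) :
    s.Pairwise (Function.onFun Commute
      fun i => (partialOp i : Module.End ℂ (ConvSeries n)) ^ β i) :=
  fun i _ j _ _ => (partialOp_commute i j).pow_pow _ _

/-- The operator `∂^β = ∂₁^β₁ ⋯ ∂ₙ^βₙ`. -/
def partialPow {n : ℕ} (β : Fin n →₀ ℕ) : Module.End ℂ (ConvSeries n) :=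
  Finset.univ.noncommProd (fun i => partialOp i ^ β i) (partialOp_pairwise β _)

theorem partialPow_zero {n : ℕ} : partialPow (0 : Fin n →₀ ℕ) = 1 := by
  unfold partialPow
  rw [Finset.noncommProd_congr rfl (fun i _ => by rw [Finsupp.coe_zero, Pi.zero_apply, pow_zero])
    (partialOp_pairwise 0 _)]
  exact (Finset.noncommProd_eq_pow_card _ _ _ 1 fun _ _ => rfl).trans (one_pow _)

/-- The operator `∑_β p_β(x) ∂^β` given by a finite family of coefficients `p_β`. -/
def opOf (n : ℕ) : ((Fin n →₀ ℕ) →₀ ConvSeries n) →ₗ[ℂ] Module.End ℂ (ConvSeries n) :=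
  Finsupp.lsum ℂ fun β =>
    (LinearMap.mulRight ℂ (partialPow β)) ∘ₗ (LinearMap.mul ℂ (ConvSeries n))

theorem opOf_single {n : ℕ} (β : Fin n →₀ ℕ) (a : ConvSeries n) :
    opOf n (Finsupp.single β a) = mulOp a * partialPow β := by
  simp only [opOf, Finsupp.lsum_single]
  rfl

theorem partialPow_add_single {n : ℕ} (β : Fin n →₀ ℕ) (i : Fin n) :
    partialPow (β + Finsupp.single i 1) = partialOp i * partialPow β := by
  classical
  have key : ∀ s : Finset (Fin n),
      s.noncommProd (fun j => (partialOp j : Module.End ℂ (ConvSeries n)) ^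
          (β + Finsupp.single i 1 : Fin n →₀ ℕ) j)
        (partialOp_pairwise _ _) =
      (if i ∈ s then partialOp i else 1) *
      s.noncommProd (fun j => (partialOp j : Module.End ℂ (ConvSeries n)) ^ β j)
        (partialOp_pairwise _ _) := by
    intro s
    induction s using Finset.induction_on with
    | empty => simp
    | insert a s ha ih =>
      rw [Finset.noncommProd_insert_of_notMem _ _ _ _ ha,
        Finset.noncommProd_insert_of_notMem _ _ _ _ ha, ih]
      by_cases hai : a = i
      · subst hai
        simp only [Finsupp.add_apply, Finsupp.single_eq_same, ha, if_false, one_mul,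
          Finset.mem_insert, true_or, if_true]
        rw [pow_succ', mul_assoc]
      · have h1 : (β + Finsupp.single i 1 : Fin n →₀ ℕ) a = β a := by
          simp [Ne.symm hai]
        rw [h1]
        by_cases his : i ∈ s
        · simp only [his, if_true, Finset.mem_insert, or_true]
          rw [← mul_assoc, ← mul_assoc, ((partialOp_commute a i).pow_left (β a)).eq]
        · simp only [his, if_false, Finset.mem_insert, or_false, Ne.symm hai, one_mul]
  simpa [partialPow] using key Finset.univ

theorem coeff_partialPow {n : ℕ} (β : Fin n →₀ ℕ) :
    ∃ c : (Fin n →₀ ℕ) → ℂ, (∀ α, c α ≠ 0) ∧ ∀ (f : ConvSeries n) (α : Fin n →₀ ℕ),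
      MvPowerSeries.coeff α (partialPow β f).toSeries = c α * MvPowerSeries.coeff (α + β) f.toSeries := by
  induction hd : β.degree generalizing β with
  | zero =>
    obtain rfl : β = 0 := (Finsupp.degree_eq_zero_iff β).mp hd
    refine ⟨fun _ => 1, fun _ => one_ne_zero, fun f α => ?_⟩
    simp [partialPow_zero]
  | succ d ih =>
    have hne : β ≠ 0 := by
      rintro rfl
      simp at hd
    obtain ⟨i, hi⟩ := Finsupp.ne_iff.mp hne
    have hle : Finsupp.single i 1 ≤ β := by
      rw [Finsupp.single_le_iff]
      exact Nat.one_le_iff_ne_zero.mpr (by simpa using hi)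
    obtain ⟨γ, rfl⟩ : ∃ γ, β = γ + Finsupp.single i 1 :=
      ⟨β - Finsupp.single i 1, (tsub_add_cancel_of_le hle).symm⟩
    obtain ⟨c, hc, h⟩ := ih γ (by simpa using hd)
    refine ⟨fun α => c (α + Finsupp.single i 1) * (α i + 1), fun α => mul_ne_zero (hc _) ?_,
      fun f α => ?_⟩
    · exact_mod_cast Nat.succ_ne_zero (α i)
    · rw [partialPow_add_single]
      change MvPowerSeries.coeff α (MvPowerSeries.pderiv ℂ i (partialPow γ f).toSeries) = _
      rw [MvPowerSeries.coeff_pderiv, h, add_assoc, add_comm (Finsupp.single i 1) γ]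
      ring

theorem monomial_mem {n : ℕ} (β : Fin n →₀ ℕ) :
    MvPowerSeries.monomial β (1 : ℂ) ∈ convergentSeries n := by
  classical
  refine ⟨1, one_pos, summable_of_ne_finset_zero (s := {β}) fun α hα => ?_⟩
  rw [MvPowerSeries.coeff_monomial, if_neg (by simpa using hα)]
  simp

theorem opOf_injective (n : ℕ) : Function.Injective (opOf n) := by
  classical
  rw [← LinearMap.ker_eq_bot, LinearMap.ker_eq_bot']
  intro p hp
  by_contra hne
  obtain ⟨β₀, hβ₀, hmin⟩ := Finset.exists_min_image p.support Finsupp.degree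
    (Finsupp.support_nonempty_iff.mpr hne)
  have hev : opOf n p (ConvSeries.mk (MvPowerSeries.monomial β₀ 1) (monomial_mem β₀)) = 0 := by rw [hp]; rfl
  have hsum : opOf n p = ∑ β ∈ p.support, mulOp (p β) * partialPow β := by
    conv_lhs => rw [← Finsupp.sum_single p]
    rw [Finsupp.sum, map_sum]
    exact Finset.sum_congr rfl fun β _ => opOf_single β _
  rw [hsum, LinearMap.sum_apply, Finset.sum_eq_single_of_mem β₀ hβ₀] at hev
  · obtain ⟨c, hc, h⟩ := coeff_partialPow β₀
    have hconst : (partialPow β₀ (ConvSeries.mk (MvPowerSeries.monomial β₀ 1) (monomial_mem β₀)) :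
        ConvSeries n).toSeries = MvPowerSeries.C (c 0) := by
      ext α
      rw [h, ConvSeries.toSeries_mk, MvPowerSeries.coeff_monomial, MvPowerSeries.coeff_C]
      by_cases hα : α = 0
      · simp [hα]
      · simp [hα]
    have hz : (p β₀).toSeries * MvPowerSeries.C (c 0) = 0 := by
      rw [← hconst]
      exact congrArg ConvSeries.toSeries hev
    have hp0 : (p β₀).toSeries = 0 := by
      rcases mul_eq_zero.mp hz with h0 | h0
      · exact h0
      · exact absurd (by simpa using congrArg (MvPowerSeries.coeff 0) h0) (hc 0)
    exact (Finsupp.mem_support_iff.mp hβ₀) (ConvSeries.ext (hp0.trans (map_zero _).symm))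
  · intro β hβ hne'
    have hz : (partialPow β (ConvSeries.mk (MvPowerSeries.monomial β₀ 1) (monomial_mem β₀)) :
        ConvSeries n) = 0 := by
      obtain ⟨c, hc, h⟩ := coeff_partialPow β
      refine ConvSeries.ext (MvPowerSeries.ext fun α => ?_)
      rw [h, ConvSeries.toSeries_mk, MvPowerSeries.coeff_monomial, if_neg]
      · simp
      · intro hab
        have h1 := hmin β hβ
        rw [← hab, map_add] at h1
        have h2 : α = 0 := (Finsupp.degree_eq_zero_iff α).mp (by omega)
        exact hne' (by rw [← hab, h2, zero_add])
    change mulOp (p β) (partialPow β _) = 0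
    rw [hz, map_zero]

theorem partialOp_mul_mulOp {n : ℕ} (i : Fin n) (a : ConvSeries n) :
    partialOp i * mulOp a = mulOp a * partialOp i + mulOp (partialOp i a) := by
  refine LinearMap.ext fun f => ConvSeries.ext ?_
  change MvPowerSeries.pderiv ℂ i (a.toSeries * f.toSeries) =
    a.toSeries * MvPowerSeries.pderiv ℂ i f.toSeries +
      MvPowerSeries.pderiv ℂ i a.toSeries * f.toSeries
  rw [Derivation.leibniz]
  simp only [smul_eq_mul]
  ring

theorem partialPow_mem {n : ℕ} (β : Fin n →₀ ℕ) : partialPow β ∈ diffOps n := by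
  unfold partialPow
  refine Submonoid.noncommProd_mem (diffOps n).toSubmonoid _ _ _ fun i _ => ?_
  have h : (partialOp i : Module.End ℂ (ConvSeries n)) ∈ diffOps n :=
    Algebra.subset_adjoin (Or.inr ⟨i, rfl⟩)
  exact pow_mem h _

theorem range_opOf (n : ℕ) :
    LinearMap.range (opOf n) = Subalgebra.toSubmodule (diffOps n) := by
  apply le_antisymm
  · rintro _ ⟨p, rfl⟩
    induction p using Finsupp.induction_linear with
    | zero => simp
    | add p q hp hq => rw [map_add]; exact add_mem hp hq
    | single β a =>
      rw [opOf_single]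
      have h : mulOp a ∈ diffOps n := Algebra.subset_adjoin (Or.inl ⟨a, rfl⟩)
      exact (diffOps n).mul_mem h (partialPow_mem β)
  · have hleft : ∀ x ∈ Set.range (mulOp (n := n)) ∪ Set.range partialOp,
        ∀ y ∈ LinearMap.range (opOf n), x * y ∈ LinearMap.range (opOf n) := by
      rintro x hx _ ⟨p, rfl⟩
      induction p using Finsupp.induction_linear with
      | zero => simp
      | add p q hp hq => rw [map_add, mul_add]; exact add_mem hp hq
      | single β a =>
        rw [opOf_single]
        rcases hx with ⟨b, rfl⟩ | ⟨i, rfl⟩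
        · refine ⟨Finsupp.single β (b * a), ?_⟩
          rw [opOf_single, ← mul_assoc]
          congr 1
          exact LinearMap.ext fun f => mul_assoc b a f
        · refine ⟨Finsupp.single (β + Finsupp.single i 1) a +
            Finsupp.single β (partialOp i a), ?_⟩
          rw [map_add, opOf_single, opOf_single, partialPow_add_single, ← mul_assoc,
            ← mul_assoc, partialOp_mul_mulOp, add_mul]
    have hone : (1 : Module.End ℂ (ConvSeries n)) ∈ LinearMap.range (opOf n) := by
      refine ⟨Finsupp.single 0 1, ?_⟩
      rw [opOf_single]
      rw [partialPow_zero, mul_one]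
      exact LinearMap.mulLeft_one ℂ _
    have hall : ∀ x ∈ diffOps n,
        ∀ y ∈ LinearMap.range (opOf n), x * y ∈ LinearMap.range (opOf n) := by
      intro x hx
      induction hx using Algebra.adjoin_induction with
      | mem x hx => exact hleft x hx
      | algebraMap c =>
        intro y hy
        rw [← Algebra.smul_def]
        exact Submodule.smul_mem _ _ hy
      | add x y _ _ hx hy =>
        intro z hz
        rw [add_mul]
        exact add_mem (hx z hz) (hy z hz)
      | mul x y _ _ hx hy =>
        intro z hz
        rw [mul_assoc]
        exact hx _ (hy z hz)
    intro x hx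
    simpa using hall x hx 1 hone

/-- Every `P ∈ 𝒟` has a unique expression `P = ∑_β p_β(x) ∂^β`; this is the family `(p_β)_β`. -/
def normalForm (n : ℕ) : D n ≃ₗ[ℂ] ((Fin n →₀ ℕ) →₀ ConvSeries n) :=
  ((LinearEquiv.ofInjective (opOf n) (opOf_injective n)).trans
    (LinearEquiv.ofEq _ _ (range_opOf n))).symm

theorem opOf_normalForm {n : ℕ} (P : D n) : opOf n (normalForm n P) = P.toEnd :=
  congrArg Subtype.val ((normalForm n).symm_apply_apply P)

/-- The coefficient `p_{αβ}` of `x^α ∂^β` in `P ∈ 𝒟`. -/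
def opCoeff {n : ℕ} (P : D n) (α β : Fin n →₀ ℕ) : ℂ :=
  MvPowerSeries.coeff α (normalForm n P β).toSeries

/-- The usual order of a differential operator (with value `0` at `P = 0`). -/
def opOrder {n : ℕ} (P : D n) : ℕ :=
  (normalForm n P).support.sup Finsupp.degree

/-! ### The `V`-multifiltrations -/

/-- The Malgrange–Kashiwara filtration `V^{(i)}_ℓ(𝒟)` along the hypersurface `xᵢ = 0`. -/
def VAlong {n : ℕ} (i : Fin n) (l : ℤ) : Submodule ℂ (D n) where
  carrier := {P | ∀ α β, opCoeff P α β ≠ 0 → (β i : ℤ) - α i ≤ l}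
  zero_mem' := by
    intro α β h
    simp [opCoeff] at h
  add_mem' := by
    intro P Q hP hQ α β h
    by_cases h1 : opCoeff P α β = 0
    · by_cases h2 : opCoeff Q α β = 0
      · exfalso
        apply h
        unfold opCoeff at h1 h2 ⊢
        simp [h1, h2]
      · exact hQ α β h2
    · exact hP α β h1
  smul_mem' := by
    intro c P hP α β h
    refine hP α β fun h1 => h ?_
    unfold opCoeff at h1 ⊢
    simp [h1]

/-- The multifiltration `V_s(𝒟) = ⋂ᵢ V^{(i)}_{sᵢ}(𝒟)`, `s ∈ ℤᵏ`, along
`x₁ = 0, …, x_k = 0`. -/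
def V {n k : ℕ} (hk : k ≤ n) (s : Fin k → ℤ) : Submodule ℂ (D n) :=
  ⨅ i : Fin k, VAlong (Fin.castLE hk i) (s i)

/-- The shifted multifiltration `V[m]_s(𝒟ʳ) = ⨁ⱼ V_{s - m⁽ʲ⁾}(𝒟)` of the free module `𝒟ʳ`. -/
def VFree {n k r : ℕ} (hk : k ≤ n) (m : Fin r → Fin k → ℤ) (s : Fin k → ℤ) :
    Submodule ℂ (Fin r → D n) :=
  Submodule.pi Set.univ fun j => V hk (s - m j)

/-- The good multifiltration `U_s(M) = (V[m]_s(𝒟ʳ) + N) / N` of `M = 𝒟ʳ / N`. -/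
def U {n k r : ℕ} (hk : k ≤ n) (m : Fin r → Fin k → ℤ) (N : Submodule (D n) (Fin r → D n))
    (s : Fin k → ℤ) : Submodule ℂ ((Fin r → D n) ⧸ N) :=
  (VFree hk m s).map (N.mkQ.restrictScalars ℂ)

/-- A basic cone in the first quadrant of the dual of `ℚᵏ`: it is generated by linear forms
`L₁,…,L_k` (the rows of `form`) with non-negative integer coefficients, which form a basis of the
lattice `ℤᵏ`. They are the primitive elements of its `1`-skeleton. -/
structure BasicCone (k : ℕ) where
  form : Matrix (Fin k) (Fin k) ℤ
  form_nonneg : ∀ i j, 0 ≤ form i j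
  isUnit_det : IsUnit form.det

/-- The cone itself, as a set of linear forms on `ℚᵏ` (given by their coefficients). -/
def BasicCone.cone {k : ℕ} (Γ : BasicCone k) : Set (Fin k → ℚ) :=
  {γ | ∃ c : Fin k → ℚ, (∀ i, 0 ≤ c i) ∧ γ = fun j => ∑ i, c i * (Γ.form i j : ℚ)}

/-- The lattice points `Γ̌ ∩ ℤᵏ` of the dual cone. -/
def BasicCone.dual {k : ℕ} (Γ : BasicCone k) : AddSubmonoid (Fin k → ℤ) where
  carrier := {a | ∀ γ ∈ Γ.cone, 0 ≤ ∑ j, γ j * (a j : ℚ)}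
  zero_mem' := by
    intro γ _
    simp
  add_mem' := by
    intro a b ha hb γ hγ
    have := add_nonneg (ha γ hγ) (hb γ hγ)
    simpa [mul_add, Finset.sum_add_distrib] using this

/-- The filtration `U^Γ_s(M)`: the sum of the `U_σ(M)` over all `σ ∈ ℤᵏ` with `L(σ) ≤ L(s)` for
every primitive generator `L` of `Γ`. -/
def UCone {n k r : ℕ} (hk : k ≤ n) (m : Fin r → Fin k → ℤ) (N : Submodule (D n) (Fin r → D n))
    (Γ : BasicCone k) (s : Fin k → ℤ) : Submodule ℂ ((Fin r → D n) ⧸ N) :=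
  ⨆ (σ : Fin k → ℤ) (_ : ∀ i, Γ.form.mulVec σ i ≤ Γ.form.mulVec s i), U hk m N σ

/-! ### Rees modules -/

/-- The ring of Laurent polynomials `ℂ[u₁^{±1},…,u_k^{±1}]`. -/
abbrev Laurent (k : ℕ) : Type := AddMonoidAlgebra ℂ (Fin k → ℤ)

/-- The monomial `u^a`. -/
def uPow {k : ℕ} (a : Fin k → ℤ) : Laurent k := AddMonoidAlgebra.single a 1

/-- The coordinate ring `A_Γ = ℂ[Γ̌ ∩ ℤᵏ] ⊆ ℂ[u^{±1}]`, generated by the monomials `u^a` with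
`a ∈ Γ̌ ∩ ℤᵏ`. -/
def BasicCone.coordRing {k : ℕ} (Γ : BasicCone k) : Subalgebra ℂ (Laurent k) :=
  Algebra.adjoin ℂ (uPow '' (Γ.dual : Set (Fin k → ℤ)))

theorem BasicCone.form_row_mem {k : ℕ} (Γ : BasicCone k) (i : Fin k) :
    (fun j => (Γ.form i j : ℚ)) ∈ Γ.cone := by
  classical
  refine ⟨Pi.single i 1, fun j => ?_, ?_⟩
  · by_cases h : j = i
    · subst h; simp
    · simp [h]
  · funext j
    simp [Pi.single_apply]

theorem UCone_mono {n k r : ℕ} (hk : k ≤ n) (m : Fin r → Fin k → ℤ)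
    (N : Submodule (D n) (Fin r → D n)) (Γ : BasicCone k) (s : Fin k → ℤ) {a : Fin k → ℤ}
    (ha : a ∈ Γ.dual) : UCone hk m N Γ s ≤ UCone hk m N Γ (a + s) := by
  refine iSup₂_le fun σ hσ => le_iSup₂_of_le σ (fun i => (hσ i).trans ?_) le_rfl
  rw [Matrix.mulVec_add, Pi.add_apply]
  have h := ha _ (Γ.form_row_mem i)
  have h2 : (0 : ℤ) ≤ Γ.form.mulVec a i := by
    have : (0 : ℚ) ≤ ((Γ.form.mulVec a i : ℤ) : ℚ) := by
      simpa [Matrix.mulVec, dotProduct] using h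
    exact_mod_cast this
  linarith

/-- The component `W · u^s` of `M[u^{±1}] = ℂ[u^{±1}] ⊗ M`, for a subspace `W ⊆ M`. -/
def uComponent {k : ℕ} {M : Type} [AddCommGroup M] [Module ℂ M] (s : Fin k → ℤ)
    (W : Submodule ℂ M) : Submodule ℂ (Laurent k ⊗[ℂ] M) :=
  W.map (TensorProduct.mk ℂ (Laurent k) M (uPow s))

theorem rees_smul_mem {n k r : ℕ} (hk : k ≤ n) (m : Fin r → Fin k → ℤ)
    (N : Submodule (D n) (Fin r → D n)) (Γ : BasicCone k) (a : Laurent k)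
    (ha : a ∈ Γ.coordRing) :
    ∀ z ∈ (⨆ s, uComponent s (UCone hk m N Γ s) :
        Submodule ℂ (Laurent k ⊗[ℂ] ((Fin r → D n) ⧸ N))),
      a • z ∈ (⨆ s, uComponent s (UCone hk m N Γ s) :
        Submodule ℂ (Laurent k ⊗[ℂ] ((Fin r → D n) ⧸ N))) := by
  induction ha using Algebra.adjoin_induction with
  | mem x hx =>
    obtain ⟨c, hc, rfl⟩ := hx
    intro z hz
    induction hz using Submodule.iSup_induction' with
    | mem s z hz =>
      obtain ⟨w, hw, rfl⟩ := hz
      refine Submodule.mem_iSup_of_mem (c + s) ⟨w, UCone_mono hk m N Γ s hc hw, ?_⟩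
      simp [uPow, TensorProduct.smul_tmul', AddMonoidAlgebra.single_mul_single]
    | zero => simp
    | add y z _ _ hy hz => rw [smul_add]; exact add_mem hy hz
  | algebraMap c =>
    intro z hz
    rw [algebraMap_smul]
    exact Submodule.smul_mem _ _ hz
  | add x y _ _ hx hy =>
    intro z hz
    rw [add_smul]
    exact add_mem (hx z hz) (hy z hz)
  | mul x y _ _ hx hy =>
    intro z hz
    rw [mul_smul]
    exact hx _ (hy z hz)

/-- The Rees module `R^Γ(M) = ⨁_s U^Γ_s(M) u^s ⊆ M[u^{±1}]` of `M = 𝒟ʳ / N`, as a module over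
`A_Γ`. -/
def reesModule {n k r : ℕ} (hk : k ≤ n) (m : Fin r → Fin k → ℤ)
    (N : Submodule (D n) (Fin r → D n)) (Γ : BasicCone k) :
    Submodule Γ.coordRing (Laurent k ⊗[ℂ] ((Fin r → D n) ⧸ N)) where
  carrier := (⨆ s, uComponent s (UCone hk m N Γ s) :
    Submodule ℂ (Laurent k ⊗[ℂ] ((Fin r → D n) ⧸ N)))
  zero_mem' := zero_mem _
  add_mem' := add_mem
  smul_mem' a z hz := rees_smul_mem hk m N Γ a.1 a.2 z hz

/-! ### Homogenization and the analytic standard fan -/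

/-- The homogenized ring `𝒟[t]`, realized as the Rees ring `⨁_ℓ F_ℓ(𝒟) v^ℓ ⊆ 𝒟[v]` of the order
filtration: it is generated by the series `a ∈ ℂ{x}`, by `∂ⱼ v` (written `∂ⱼ` in `𝒟[t]`) and by
`t = v`. A monomial `x^α ∂^β t^ℓ` of `𝒟[t]` is thus `x^α ∂^β v^{|β| + ℓ}`. -/
def homogRing (n : ℕ) : Subalgebra ℂ (Polynomial (D n)) :=
  Algebra.adjoin ℂ (Set.range (fun a : ConvSeries n => Polynomial.C (D.ofSeries a)) ∪
    Set.range (fun i : Fin n => Polynomial.monomial 1 (D.partial i)) ∪ {Polynomial.X})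

/-- The homogenization of `P = (P₁,…,P_r) ∈ 𝒟ʳ`: it is `(P₁ v^d,…,P_r v^d)`, that is
`(t^{d-d₁} h(P₁),…,t^{d-d_r} h(P_r))`, where `dⱼ` is the order of `Pⱼ` and `d = max dⱼ`. -/
def homogenize {n r : ℕ} (P : Fin r → D n) : Fin r → Polynomial (D n) :=
  fun j => Polynomial.monomial (Finset.univ.sup fun i => opOrder (P i)) (P j)

/-- The homogenized submodule `h(N)` of `𝒟[t]ʳ`. -/
def homogModule {n r : ℕ} (N : Submodule (D n) (Fin r → D n)) :
    Submodule (homogRing n) (Fin r → Polynomial (D n)) :=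
  Submodule.span (homogRing n) (homogenize '' (N : Set (Fin r → D n)))

/-- Indices `(j, e, α, β)` of the monomials `x^α ∂^β v^e ε_j` of `𝒟[v]ʳ`, with `ε_j` the `j`-th
basis vector. -/
abbrev MonoIdx (n r : ℕ) : Type := Fin r × ℕ × (Fin n →₀ ℕ) × (Fin n →₀ ℕ)

/-- The coefficients of an element of `𝒟[v]ʳ`. -/
def vecCoeff {n r : ℕ} (G : Fin r → Polynomial (D n)) (x : MonoIdx n r) : ℂ :=
  opCoeff ((G x.1).coeff x.2.1) x.2.2.1 x.2.2.2

/-- The degree `L(β) - L(α) + L(m⁽ʲ⁾)` of a monomial, for a linear form `L` on `ℚᵏ`. -/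
def LDegree {n k r : ℕ} (hk : k ≤ n) (m : Fin r → Fin k → ℤ) (L : Fin k → ℚ)
    (x : MonoIdx n r) : ℚ :=
  ∑ i : Fin k, L i *
    ((x.2.2.2 (Fin.castLE hk i) : ℚ) - (x.2.2.1 (Fin.castLE hk i) : ℚ) + (m x.1 i : ℚ))

open Classical in
/-- The `L`-symbol `σ^L_d(G)` of order `d`: the part of `G` of `L`-degree `d`. -/
def LSymbol {n k r : ℕ} (hk : k ≤ n) (m : Fin r → Fin k → ℤ) (L : Fin k → ℚ) (d : ℚ)
    (G : Fin r → Polynomial (D n)) : MonoIdx n r → ℂ :=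
  fun x => if LDegree hk m L x = d then vecCoeff G x else 0

/-- The graded module `gr^L(H)` of a submodule `H` of `𝒟[t]ʳ`, for the shifted `V^L`-filtration:
the sum, over all `d`, of the spaces of symbols `σ^L_d(G)` of the elements `G ∈ H` of `L`-order at
most `d`. Elements of `gr^L(𝒟[t]ʳ)`, which are finite sums of `L`-homogeneous elements, are given
by their coefficients. -/
def grL {n k r : ℕ} (hk : k ≤ n) (m : Fin r → Fin k → ℤ)
    (H : Submodule (homogRing n) (Fin r → Polynomial (D n))) (L : Fin k → ℚ) :
    Submodule ℂ (MonoIdx n r → ℂ) :=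
  Submodule.span ℂ {f | ∃ G ∈ H, ∃ d : ℚ,
    (∀ x, vecCoeff G x ≠ 0 → LDegree hk m L x ≤ d) ∧ f = LSymbol hk m L d G}

/-- The linear forms on `ℚᵏ` with non-negative coefficients. -/
def nonnegForms (k : ℕ) : Set (Fin k → ℚ) := {L | ∀ i, 0 ≤ L i}

/-- The cones of the analytic standard fan of a submodule `H` of `𝒟[t]ʳ`: the closures of the
classes of the partition of `(ℚᵏ)^*_+` according to the value of `gr^L(H)`. -/
def analyticStandardFan {n k r : ℕ} (hk : k ≤ n) (m : Fin r → Fin k → ℤ)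
    (H : Submodule (homogRing n) (Fin r → Polynomial (D n))) : Set (Set (Fin k → ℚ)) :=
  {C | ∃ L₀ ∈ nonnegForms k,
    C = closure {L | L ∈ nonnegForms k ∧ grL hk m H L = grL hk m H L₀}}

end StdFan

end

/-!
The homogeneous component of degree `e` of `h(N)` consists of the elements of `N` of order at most
`e`. Indexing operators of order at most `e` by the coefficients of the finitely many `∂^β ε_j`
turns it into a submodule `N_e` of a free `ℂ{x}`-module of finite rank (`boundedPart`), so that
everything takes place in commutative algebra.

Fix a weight `w` with distinct values on the monomials. For a linear form `L ≥ 0` let `E_L` be the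
set of leading monomials of the elements of `N_e`, for the order given by the `L`-degree, ties being
broken by `w`. Then `E_L` depends only on `gr^L(h(N))` (`leadSet_subset_of_grL_eq`), hence it is the
same set `E` for all the forms of a class of the partition defining the fan. Division by `N_e` with
respect to `L`, with convergence (`exists_remainder`), writes every vector in a unique way as the
sum of an element of `N_e` and of a remainder without monomials in `E`, and the remainder has at
most the `L`-degree of the original vector. By uniqueness the remainder is the same for all `L` of
the class; by density, division respects the steps of the multifiltration attached to a basic cone
contained in the closure of the class (`exists_cone_remainder`).

Convergence comes from `ℓ¹` norms: for suitable weights on the monomials, each of the finitely many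
vectors needed for the division is close to its leading monomial, and division amounts to inverting
a small perturbation of the identity (`exists_eq_add_tsum`).

The part of order at most `e` of the Rees module is therefore the Rees module of a space of
convergent vectors with prescribed monomials, where the filtration is given by conditions on the
monomials. Such a space splits along any finite partition of the set of monomials. So
finitely many elements of the Rees module involve only a finite sum of submodules
`A_Γ u^g ⊗ Y`, which is free, and flatness follows from the equational criterion
(`flat_of_forall_finset`, `exists_flat_submodule`).
-/

noncomputable section

namespace StdFan

/-! ### Perturbation of the identity in weighted `ℓ¹` spaces -/

theorem exists_eq_add_tsum_of_norm_le_half {B : Type*} (h : B → B → ℂ)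
    (hs : ∀ a, Summable fun b => ‖h a b‖) (hb : ∀ a, ∑' b, ‖h a b‖ ≤ 1 / 2)
    (f : B → ℂ) (hf : Summable fun b => ‖f b‖) :
    ∃ u : B → ℂ, (Summable fun b => ‖u b‖) ∧ ∀ b, f b = u b + ∑' a, u a * h a b := by
  have hmem : ∀ g : B → ℂ, (Summable fun b => ‖g b‖) → Memℓp g 1 := fun g hg =>
    memℓp_gen (by simpa using hg)
  have hmem' : ∀ x : lp (fun _ : B => ℂ) 1, Summable fun b => ‖x b‖ := fun x => by
    simpa using (lp.memℓp x).summable (by simp)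
  have hnorm : ∀ x : lp (fun _ : B => ℂ) 1, ‖x‖ = ∑' b, ‖x b‖ := fun x => by
    rw [lp.norm_eq_tsum_rpow (by simp)]
    simp
  let H : B → lp (fun _ : B => ℂ) 1 := fun a => ⟨h a, hmem _ (hs a)⟩
  have hH : ∀ a, ‖H a‖ ≤ 1 / 2 := fun a => (hnorm (H a)).le.trans (hb a)
  have hle : ∀ (x : lp (fun _ : B => ℂ) 1) a, ‖x a • H a‖ ≤ ‖x a‖ * (1 / 2) := fun x a => by
    rw [norm_smul]
    exact mul_le_mul_of_nonneg_left (hH a) (norm_nonneg _)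
  have hsum : ∀ x : lp (fun _ : B => ℂ) 1, Summable fun a => x a • H a := fun x =>
    Summable.of_norm_bounded ((hmem' x).mul_right _) (hle x)
  let T₀ : lp (fun _ : B => ℂ) 1 →ₗ[ℂ] lp (fun _ : B => ℂ) 1 :=
    { toFun := fun x => ∑' a, x a • H a
      map_add' := fun x y => by
        rw [← (hsum x).tsum_add (hsum y)]
        exact tsum_congr fun a => by rw [lp.coeFn_add, Pi.add_apply, add_smul]
      map_smul' := fun c x => by
        rw [RingHom.id_apply, ← (hsum x).tsum_const_smul]
        exact tsum_congr fun a => by rw [lp.coeFn_smul, Pi.smul_apply, smul_assoc] }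
  let T : lp (fun _ : B => ℂ) 1 →L[ℂ] lp (fun _ : B => ℂ) 1 := T₀.mkContinuous (1 / 2) fun x => by
    refine (tsum_of_norm_bounded ((hmem' x).mul_right (1 / 2)).hasSum (hle x)).trans (le_of_eq ?_)
    rw [tsum_mul_right, hnorm, mul_comm]
  have hT : ‖-T‖ < 1 := by
    rw [norm_neg]
    exact (T₀.mkContinuous_norm_le (by norm_num) _).trans_lt (by norm_num)
  let f' : lp (fun _ : B => ℂ) 1 := ⟨f, hmem f hf⟩
  let Q := Units.oneSub (-T) hT
  let u : lp (fun _ : B => ℂ) 1 := Q.inv f'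
  have hu : f' = u + T u := by
    have h1 : (Q.val * Q.inv) f' = f' := by
      rw [Q.val_inv]; rfl
    rw [mul_apply_eq_comp, Units.val_oneSub, sub_neg_eq_add] at h1
    exact h1.symm
  refine ⟨u, hmem' u, fun b => ?_⟩
  have h2 : f b = u b + (T u) b := by
    have := congrArg (fun z : lp (fun _ : B => ℂ) 1 => z b) hu
    simpa using this
  rw [h2]
  congr 1
  exact ((lp.evalCLM ℂ (fun _ : B => ℂ) (p := 1) b).map_tsum (hsum u)).trans
    (tsum_congr fun a => rfl)

/-- If the columns `h a` are at most half as long as the basis vectors `δ a`, in the `ℓ¹` norm with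
weights `W`, then `u ↦ u + ∑ u a • h a` is onto. -/
theorem exists_eq_add_tsum {B : Type*} (W : B → ℝ) (hW : ∀ b, 0 < W b) (h : B → B → ℂ)
    (hs : ∀ a, Summable fun b => ‖h a b‖ * W b) (hb : ∀ a, ∑' b, ‖h a b‖ * W b ≤ 1 / 2 * W a)
    (f : B → ℂ) (hf : Summable fun b => ‖f b‖ * W b) :
    ∃ u : B → ℂ, (Summable fun b => ‖u b‖ * W b) ∧ ∀ b, f b = u b + ∑' a, u a * h a b := by
  have hn : ∀ b, ‖(W b : ℂ)‖ = W b := fun b => by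
    rw [Complex.norm_real, Real.norm_of_nonneg (hW b).le]
  have h0 : ∀ b, (W b : ℂ) ≠ 0 := fun b => by exact_mod_cast (hW b).ne'
  have he : ∀ a b, ‖h a b * W b / W a‖ = ‖h a b‖ * W b / W a := fun a b => by
    rw [norm_div, norm_mul, hn, hn]
  obtain ⟨u, hu, hfu⟩ := exists_eq_add_tsum_of_norm_le_half (fun a b => h a b * W b / W a)
    (fun a => by simpa only [he] using (hs a).div_const _)
    (fun a => by
      simp only [he, tsum_div_const]
      rw [div_le_iff₀ (hW a)]
      exact hb a) (fun b => f b * W b)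
    (by simpa only [norm_mul, hn] using hf)
  refine ⟨fun b => u b / W b, ?_, fun b => ?_⟩
  · refine hu.congr fun b => ?_
    rw [norm_div, hn, div_mul_cancel₀ _ (hW b).ne']
  · have h1 := congrArg (· / (W b : ℂ)) (hfu b)
    simp only [mul_div_cancel_right₀ _ (h0 b), add_div] at h1
    rw [h1, ← tsum_div_const]
    congr 1
    refine tsum_congr fun a => ?_
    have := h0 a
    have := h0 b
    field_simp

/-! ### Monomials and weights -/

/-- Dickson's lemma. -/
theorem exists_finset_forall_exists_le {n : ℕ} (S : Set (Fin n →₀ ℕ)) :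
    ∃ T : Finset (Fin n →₀ ℕ), (T : Set (Fin n →₀ ℕ)) ⊆ S ∧ ∀ a ∈ S, ∃ t ∈ T, t ≤ a := by
  have hfin : {a | Minimal (· ∈ S) a}.Finite :=
    WellQuasiOrderedLE.finite_of_isAntichain (setOfPred_minimal_antichain _)
  refine ⟨hfin.toFinset, fun a ha => ?_, fun a ha => ?_⟩
  · exact (hfin.mem_toFinset.mp ha).1
  · obtain ⟨t, hta, ht⟩ := exists_minimal_le_of_wellFoundedLT (· ∈ S) a ha
    exact ⟨t, hfin.mem_toFinset.mpr ht, hta⟩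

/-- The affine weight `τ j + φ α` of the monomial `x^α ε_j`. -/
def wt {n : ℕ} {ι : Type*} (φ : (Fin n →₀ ℕ) →+ ℝ) (τ : ι → ℝ) (b : ι × (Fin n →₀ ℕ)) : ℝ :=
  τ b.1 + φ b.2

theorem wt_add {n : ℕ} {ι : Type*} (φ : (Fin n →₀ ℕ) →+ ℝ) (τ : ι → ℝ) (j : ι)
    (α β : Fin n →₀ ℕ) : wt φ τ (j, α + β) = wt φ τ (j, α) + φ β := by
  simp only [wt, map_add, add_assoc]

theorem exists_forall_wt_le {n : ℕ} {ι : Type*} [Finite ι] (φ : (Fin n →₀ ℕ) →+ ℝ)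
    (hφ : ∀ α, 0 ≤ φ α) (τ : ι → ℝ) {S : Set (ι × (Fin n →₀ ℕ))} (hS : S.Nonempty) :
    ∃ a ∈ S, ∀ b ∈ S, wt φ τ a ≤ wt φ τ b := by
  choose T hTS hT using fun j => exists_finset_forall_exists_le {α | (j, α) ∈ S}
  have hfin : {b : ι × (Fin n →₀ ℕ) | b.2 ∈ T b.1}.Finite := by
    have : {b : ι × (Fin n →₀ ℕ) | b.2 ∈ T b.1} ⊆ ⋃ j, Prod.mk j '' (T j : Set (Fin n →₀ ℕ)) :=
      fun b hb => Set.mem_iUnion.mpr ⟨b.1, b.2, hb, rfl⟩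
    exact (Set.finite_iUnion fun j => (T j).finite_toSet.image _).subset this
  obtain ⟨b₀, hb₀⟩ := hS
  obtain ⟨t₀, ht₀, -⟩ := hT b₀.1 b₀.2 hb₀
  obtain ⟨a, ha, hmin⟩ := hfin.exists_minimalFor (wt φ τ) _ ⟨(b₀.1, t₀), ht₀⟩
  refine ⟨a, hTS a.1 ha, fun b hb => ?_⟩
  obtain ⟨t, ht, htb⟩ := hT b.1 b.2 hb
  obtain ⟨γ, hγ⟩ := exists_add_of_le htb
  have h1 : wt φ τ a ≤ wt φ τ (b.1, t) := by
    rcases le_total (wt φ τ a) (wt φ τ (b.1, t)) with h | h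
    · exact h
    · exact hmin (show (b.1, t) ∈ _ from ht) h
  have h2 : wt φ τ b = wt φ τ (b.1, t) + φ γ := by rw [← wt_add, ← hγ]
  linarith [hφ γ]

/-- A weight which separates all monomials and grows at least linearly with the degree; it serves
to break ties. -/
theorem exists_injective_wt (n : ℕ) (ι : Type*) [Finite ι] :
    ∃ (φ : (Fin n →₀ ℕ) →+ ℝ) (τ : ι → ℝ), (∀ α, Real.log 2 * α.degree ≤ φ α) ∧
      Function.Injective (wt φ τ) := by
  obtain ⟨q, ⟨e⟩⟩ := Finite.exists_equiv_fin ι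
  let p : Fin n ⊕ Fin q → ℕ := fun i => Nat.nth Nat.Prime (finSumFinEquiv i)
  have hp : ∀ i, (p i).Prime := fun i => Nat.prime_nth_prime _
  have hpinj : Function.Injective p := fun i j h => finSumFinEquiv.injective
    (Fin.ext (Nat.nth_injective Nat.infinite_setOfPred_prime h))
  let φ : (Fin n →₀ ℕ) →+ ℝ :=
    { toFun := fun α => ∑ i, α i * Real.log (p (Sum.inl i))
      map_zero' := by simp
      map_add' := fun α β => by simp [add_mul, Finset.sum_add_distrib] }
  refine ⟨φ, fun j => Real.log (p (Sum.inr (e j))), fun α => ?_, ?_⟩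
  · change _ ≤ ∑ i, (α i : ℝ) * Real.log (p (Sum.inl i))
    rw [Finsupp.degree_eq_sum, Nat.cast_sum, Finset.mul_sum]
    refine Finset.sum_le_sum fun i _ => ?_
    rw [mul_comm]
    refine mul_le_mul_of_nonneg_left (Real.log_le_log (by norm_num) ?_) (Nat.cast_nonneg _)
    exact_mod_cast (hp _).two_le
  · -- the weight of a monomial is the logarithm of a natural number with known factorization
    let F : ι × (Fin n →₀ ℕ) → (Fin n ⊕ Fin q →₀ ℕ) := fun b =>
      Finsupp.sumFinsuppEquivProdFinsupp.symm (b.2, Finsupp.single (e b.1) 1)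
    have hF : ∀ b, ((F b).mapDomain p).prod (· ^ ·) =
        p (Sum.inr (e b.1)) * ∏ i, p (Sum.inl i) ^ b.2 i := fun b => by
      rw [Finsupp.prod_mapDomain_index (by simp) (by simp [pow_add]),
        Finsupp.prod_fintype _ _ (by simp), Fintype.prod_sum_type, mul_comm]
      congr 1
      rw [Finset.prod_eq_single (e b.1)]
      · simp [F]
      · intro i _ hi
        simp [F, Finsupp.single_eq_of_ne hi]
      · simp
    have hwt : ∀ b, Real.exp (wt φ (fun j => Real.log (p (Sum.inr (e j)))) b) =
        (((F b).mapDomain p).prod (· ^ ·) : ℕ) := fun b => by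
      have hpos : ∀ i, (0 : ℝ) < p i := fun i => by exact_mod_cast (hp i).pos
      rw [hF, wt, Real.exp_add, Real.exp_log (hpos _)]
      change _ * Real.exp (∑ i, (b.2 i : ℝ) * Real.log (p (Sum.inl i))) = _
      rw [Real.exp_sum]
      push_cast
      congr 1
      refine Finset.prod_congr rfl fun i _ => ?_
      rw [mul_comm, Real.exp_mul, Real.exp_log (hpos _), Real.rpow_natCast]
    intro a b hab
    have h1 : ((F a).mapDomain p).prod (· ^ ·) = ((F b).mapDomain p).prod (· ^ ·) := by
      have := (hwt a).symm.trans ((congrArg Real.exp hab).trans (hwt b))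
      exact_mod_cast this
    have h2 : ∀ b, ∀ x ∈ ((F b).mapDomain p).support, Nat.Prime x := fun b x hx => by
      obtain ⟨i, -, rfl⟩ := Finset.mem_image.mp (Finsupp.mapDomain_support hx)
      exact hp i
    have h3 : F a = F b := by
      apply Finsupp.mapDomain_injective hpinj
      rw [← Nat.prod_pow_factorization_eq_self (h2 a), h1,
        Nat.prod_pow_factorization_eq_self (h2 b)]
    have h4 := Prod.ext_iff.mp (Finsupp.sumFinsuppEquivProdFinsupp.symm.injective h3)
    refine Prod.ext (e.injective ?_) h4.1
    exact (Finsupp.single_left_inj one_ne_zero).mp h4.2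

/-! ### Coefficients and restriction of supports -/

/-- The coefficient of the monomial `x^α ε_j` in a vector of convergent power series. -/
def vc {n : ℕ} {ι : Type*} (f : ι → ConvSeries n) (b : ι × (Fin n →₀ ℕ)) : ℂ :=
  MvPowerSeries.coeff b.2 (f b.1).toSeries

theorem vc_zero {n : ℕ} {ι : Type*} (b : ι × (Fin n →₀ ℕ)) :
    vc (0 : ι → ConvSeries n) b = 0 := by simp [vc]

theorem vc_add {n : ℕ} {ι : Type*} (f g : ι → ConvSeries n) (b : ι × (Fin n →₀ ℕ)) :
    vc (f + g) b = vc f b + vc g b := by simp [vc]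

theorem vc_sub {n : ℕ} {ι : Type*} (f g : ι → ConvSeries n) (b : ι × (Fin n →₀ ℕ)) :
    vc (f - g) b = vc f b - vc g b := by simp [vc]

theorem vc_smul {n : ℕ} {ι : Type*} (c : ℂ) (f : ι → ConvSeries n) (b : ι × (Fin n →₀ ℕ)) :
    vc (c • f) b = c * vc f b := by simp [vc]

theorem vc_sum {n : ℕ} {ι κ : Type*} (s : Finset κ) (f : κ → ι → ConvSeries n)
    (b : ι × (Fin n →₀ ℕ)) : vc (∑ i ∈ s, f i) b = ∑ i ∈ s, vc (f i) b := by
  simp [vc, Finset.sum_apply, map_sum]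

theorem vc_series_smul {n : ℕ} {ι : Type*} (q : ConvSeries n) (f : ι → ConvSeries n)
    (j : ι) (α : Fin n →₀ ℕ) : vc (q • f) (j, α) =
      ∑ p ∈ Finset.HasAntidiagonal.antidiagonal α,
        MvPowerSeries.coeff p.1 q.toSeries * vc f (j, p.2) := by
  simp [vc, MvPowerSeries.coeff_mul]

theorem vc_ext {n : ℕ} {ι : Type*} {f g : ι → ConvSeries n} (h : ∀ b, vc f b = vc g b) :
    f = g :=
  funext fun j => ConvSeries.ext (MvPowerSeries.ext fun α => h (j, α))

theorem exists_vc_ne_zero {n : ℕ} {ι : Type*} {f : ι → ConvSeries n} (h : f ≠ 0) :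
    ∃ b, vc f b ≠ 0 := by
  by_contra! h'
  exact h (vc_ext fun b => (h' b).trans (vc_zero b).symm)

open Classical in
/-- The part of a convergent series with exponents in `S`. -/
def ConvSeries.restrict {n : ℕ} (S : Set (Fin n →₀ ℕ)) (f : ConvSeries n) : ConvSeries n :=
  ConvSeries.mk (fun α => if α ∈ S then MvPowerSeries.coeff α f.toSeries else 0) <| by
    obtain ⟨ρ, hρ, h⟩ := f.toSeries_mem
    refine ⟨ρ, hρ, h.of_nonneg_of_le (fun α => by positivity) fun α => ?_⟩
    change ‖if α ∈ S then MvPowerSeries.coeff α f.toSeries else 0‖ * _ ≤ _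
    split_ifs
    · exact le_rfl
    · rw [norm_zero, zero_mul]
      positivity

open Classical in
theorem coeff_restrict {n : ℕ} (S : Set (Fin n →₀ ℕ)) (f : ConvSeries n) (α : Fin n →₀ ℕ) :
    MvPowerSeries.coeff α (f.restrict S).toSeries =
      if α ∈ S then MvPowerSeries.coeff α f.toSeries else 0 :=
  rfl

/-- The part of a vector of convergent series with monomials in `S`. -/
def vrestrict {n : ℕ} {ι : Type*} (S : Set (ι × (Fin n →₀ ℕ))) (f : ι → ConvSeries n) :
    ι → ConvSeries n :=
  fun j => (f j).restrict {α | (j, α) ∈ S}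

open Classical in
theorem vc_vrestrict {n : ℕ} {ι : Type*} (S : Set (ι × (Fin n →₀ ℕ))) (f : ι → ConvSeries n)
    (b : ι × (Fin n →₀ ℕ)) : vc (vrestrict S f) b = if b ∈ S then vc f b else 0 :=
  rfl

/-! ### Convergence in terms of weights -/

theorem eventually_summable_vc {n : ℕ} {ι : Type*} [Finite ι] {φ : (Fin n →₀ ℕ) →+ ℝ} {c : ℝ}
    (hc : 0 < c) (hφ : ∀ α, c * α.degree ≤ φ α) (τ : ι → ℝ) (f : ι → ConvSeries n) :
    ∀ᶠ t : ℕ in Filter.atTop, Summable fun b => ‖vc f b‖ * Real.exp (-(t * wt φ τ b)) := by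
  have key : ∀ j, ∀ᶠ t : ℕ in Filter.atTop,
      Summable fun α => ‖vc f (j, α)‖ * Real.exp (-(t * wt φ τ (j, α))) := by
    intro j
    obtain ⟨ρ, hρ, h⟩ := (f j).toSeries_mem
    have ht : Filter.Tendsto (fun t : ℕ => Real.exp (-(t * c))) Filter.atTop (nhds 0) :=
      Real.tendsto_exp_neg_atTop_nhds_zero.comp
        (tendsto_natCast_atTop_atTop.atTop_mul_const hc)
    filter_upwards [ht.eventually (ge_mem_nhds hρ)] with t ht
    refine (h.mul_left (Real.exp (-(t * τ j)))).of_nonneg_of_le (fun α => by positivity) fun α => ?_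
    have h1 : Real.exp (-(t * wt φ τ (j, α))) ≤ Real.exp (-(t * τ j)) * ρ ^ α.degree := by
      calc Real.exp (-(t * wt φ τ (j, α)))
          ≤ Real.exp (-(t * τ j)) * Real.exp (-(t * c)) ^ α.degree := by
            rw [← Real.exp_nat_mul, ← Real.exp_add]
            apply Real.exp_le_exp.mpr
            have := mul_le_mul_of_nonneg_left (hφ α) (Nat.cast_nonneg (α := ℝ) t)
            simp only [wt]
            linarith
        _ ≤ _ := by gcongr
    calc ‖vc f (j, α)‖ * Real.exp (-(t * wt φ τ (j, α)))
        ≤ ‖vc f (j, α)‖ * (Real.exp (-(t * τ j)) * ρ ^ α.degree) := by gcongr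
      _ = _ := by rw [mul_left_comm]; rfl
  filter_upwards [Filter.eventually_all.mpr key] with t ht
  exact (summable_prod_of_nonneg fun b => by positivity).mpr ⟨ht, Summable.of_finite⟩

theorem exists_forall_le_mul_degree {n : ℕ} (φ : (Fin n →₀ ℕ) →+ ℝ) :
    ∃ K : ℝ, ∀ α, φ α ≤ K * α.degree := by
  refine ⟨∑ i, |φ (Finsupp.single i 1)|, fun α => ?_⟩
  have h1 : φ α = ∑ i, (α i : ℝ) * φ (Finsupp.single i 1) := by
    conv_lhs => rw [← Finsupp.univ_sum_single α, map_sum]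
    refine Finset.sum_congr rfl fun i _ => ?_
    rw [← nsmul_eq_mul, ← map_nsmul]
    simp
  rw [h1, Finset.sum_mul]
  refine Finset.sum_le_sum fun i _ => ?_
  rw [mul_comm]
  have h2 : (α i : ℝ) ≤ α.degree := by exact_mod_cast Finsupp.le_degree i α
  calc _ ≤ |φ (Finsupp.single i 1)| * (α i : ℝ) :=
        mul_le_mul_of_nonneg_right (le_abs_self _) (Nat.cast_nonneg _)
    _ ≤ _ := by gcongr

theorem mem_convergentSeries_of_summable {n : ℕ} (φ : (Fin n →₀ ℕ) →+ ℝ) {t : ℝ} (ht : 0 ≤ t)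
    (f : MvPowerSeries (Fin n) ℂ)
    (h : Summable fun α => ‖MvPowerSeries.coeff α f‖ * Real.exp (-(t * φ α))) :
    f ∈ convergentSeries n := by
  obtain ⟨K, hK⟩ := exists_forall_le_mul_degree φ
  refine ⟨Real.exp (-(t * K)), Real.exp_pos _, h.of_nonneg_of_le (fun α => by positivity)
    fun α => ?_⟩
  gcongr
  rw [← Real.exp_nat_mul]
  apply Real.exp_le_exp.mpr
  have := mul_le_mul_of_nonneg_left (hK α) ht
  linarith

/-! ### Leading exponents -/

/-- `a` is the leading monomial of `f`: the one which minimizes `ℓ`, ties being broken by `w`. -/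
def IsLead {n : ℕ} {ι : Type*} (ℓ w : ι × (Fin n →₀ ℕ) → ℝ) (f : ι → ConvSeries n)
    (a : ι × (Fin n →₀ ℕ)) : Prop :=
  vc f a ≠ 0 ∧ ∀ b, vc f b ≠ 0 → b ≠ a → ℓ a < ℓ b ∨ ℓ a = ℓ b ∧ w a < w b

/-- The set of leading monomials of the elements of `N`. -/
def leadSet {n : ℕ} {ι : Type*} (ℓ w : ι × (Fin n →₀ ℕ) → ℝ)
    (N : Submodule (ConvSeries n) (ι → ConvSeries n)) : Set (ι × (Fin n →₀ ℕ)) :=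
  {a | ∃ f ∈ N, IsLead ℓ w f a}

theorem exists_isLead {n : ℕ} {ι : Type*} [Finite ι] {φ ψ : (Fin n →₀ ℕ) →+ ℝ}
    (hφ : ∀ α, 0 ≤ φ α) (hψ : ∀ α, 0 ≤ ψ α) (τ σ : ι → ℝ) (hinj : Function.Injective (wt ψ σ))
    {f : ι → ConvSeries n} (hf : f ≠ 0) : ∃ a, IsLead (wt φ τ) (wt ψ σ) f a := by
  obtain ⟨a₀, ha₀, hmin₀⟩ := exists_forall_wt_le φ hφ τ (S := {b | vc f b ≠ 0})
    (exists_vc_ne_zero hf)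
  obtain ⟨a, ⟨ha, hae⟩, hmin⟩ := exists_forall_wt_le ψ hψ σ
    (S := {b | vc f b ≠ 0 ∧ wt φ τ b = wt φ τ a₀}) ⟨a₀, ha₀, rfl⟩
  refine ⟨a, ha, fun b hb hne => ?_⟩
  rcases (hmin₀ b hb).lt_or_eq with h | h
  · exact Or.inl (hae ▸ h)
  · refine Or.inr ⟨hae.trans h, (hmin b ⟨hb, h.symm⟩).lt_of_ne fun h' => hne (hinj h').symm⟩

/-- The lexicographic order given by `ℓ` and `w` is induced, as far as the leading monomial of a
given `f` is concerned, by the single weight `w + M ℓ` with `M` large. -/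
theorem IsLead.eventually_lt {n : ℕ} {ι : Type*} [Finite ι] {φ ψ : (Fin n →₀ ℕ) →+ ℝ}
    (hφ : ∀ α, 0 ≤ φ α) (hψ : ∀ α, 0 ≤ ψ α) {τ σ : ι → ℝ} {f : ι → ConvSeries n}
    {a : ι × (Fin n →₀ ℕ)} (ha : IsLead (wt φ τ) (wt ψ σ) f a) :
    ∀ᶠ M : ℕ in Filter.atTop, ∀ b, vc f b ≠ 0 → b ≠ a →
      wt ψ σ a + M * wt φ τ a < wt ψ σ b + M * wt φ τ b := by
  obtain ⟨m, -, hm⟩ := exists_forall_wt_le ψ hψ σ (S := Set.univ) ⟨a, trivial⟩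
  obtain ⟨δ, hδ, hgap⟩ : ∃ δ > 0, ∀ b, wt φ τ a < wt φ τ b → wt φ τ a + δ ≤ wt φ τ b := by
    by_cases hne : {b : ι × (Fin n →₀ ℕ) | wt φ τ a < wt φ τ b}.Nonempty
    · obtain ⟨c, hc, hmin⟩ := exists_forall_wt_le φ hφ τ hne
      exact ⟨wt φ τ c - wt φ τ a, sub_pos.mpr hc, fun b hb => by linarith [hmin b hb]⟩
    · exact ⟨1, one_pos, fun b hb => absurd ⟨b, hb⟩ hne⟩
  filter_upwards [(tendsto_natCast_atTop_atTop (R := ℝ)).eventually_gt_atTop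
    ((wt ψ σ a - wt ψ σ m) / δ)] with M hM b hb hba
  rcases ha.2 b hb hba with h | ⟨h, h'⟩
  · have h1 := mul_le_mul_of_nonneg_left (hgap b h) (Nat.cast_nonneg (α := ℝ) M)
    have h2 := (div_lt_iff₀ hδ).mp hM
    have h3 := hm b trivial
    linarith
  · rw [h]
    linarith

open Classical in
/-- For `t` large the norm with weights `exp (-t * wt φ τ b)` of the tail of `f` is at most half
that of its leading term. -/
theorem eventually_tsum_le_half {n : ℕ} {ι : Type*} [Finite ι] {φ : (Fin n →₀ ℕ) →+ ℝ}
    {c : ℝ} (hc : 0 < c) (hφ : ∀ α, c * α.degree ≤ φ α) (τ : ι → ℝ) {f : ι → ConvSeries n}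
    {a : ι × (Fin n →₀ ℕ)} (ha : vc f a = 1)
    (hlt : ∀ b, vc f b ≠ 0 → b ≠ a → wt φ τ a < wt φ τ b) :
    ∀ᶠ t : ℕ in Filter.atTop,
      ∑' b, ‖vc f b - (Pi.single a 1 : _ → ℂ) b‖ * Real.exp (-(t * wt φ τ b)) ≤
        1 / 2 * Real.exp (-(t * wt φ τ a)) := by
  obtain ⟨t₀, ht₀⟩ := (eventually_summable_vc hc hφ τ f).exists
  let F : ℕ → ι × (Fin n →₀ ℕ) → ℝ := fun t b =>
    ‖vc f b - (Pi.single a 1 : _ → ℂ) b‖ * Real.exp (-(t * (wt φ τ b - wt φ τ a)))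
  have hF0 : ∀ t b, vc f b = 0 ∨ b = a → F t b = 0 := by
    rintro t b h
    by_cases hb : b = a
    · subst hb
      simp [F, ha]
    · have : vc f b = 0 := h.resolve_right hb
      simp [F, this, hb]
  have hF1 : ∀ t b, b ≠ a → F t b = ‖vc f b‖ * Real.exp (-(t * (wt φ τ b - wt φ τ a))) := by
    intro t b hb
    simp [F, hb]
  have hlim : Filter.Tendsto (fun t => ∑' b, F t b) Filter.atTop 
      (nhds (∑' _ : ι × (Fin n →₀ ℕ), (0 : ℝ))) := by
    refine tendsto_tsum_of_dominated_convergence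
      (bound := fun b => ‖vc f b‖ * Real.exp (-(t₀ * wt φ τ b)) * Real.exp (t₀ * wt φ τ a))
      (ht₀.mul_right _) (fun b => ?_) ?_
    · by_cases hb : vc f b = 0 ∨ b = a
      · simp only [hF0 _ b hb, tendsto_const_nhds]
      · push Not at hb
        simp only [hF1 _ b hb.2]
        rw [← mul_zero ‖vc f b‖]
        exact (Real.tendsto_exp_neg_atTop_nhds_zero.comp
          (tendsto_natCast_atTop_atTop.atTop_mul_const (sub_pos.mpr (hlt b hb.1 hb.2)))).const_mul _
    · filter_upwards [Filter.eventually_ge_atTop t₀] with t ht b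
      by_cases hb : vc f b = 0 ∨ b = a
      · rw [hF0 _ b hb, norm_zero]
        positivity
      · push Not at hb
        rw [hF1 _ b hb.2, Real.norm_of_nonneg (by positivity), mul_assoc, ← Real.exp_add]
        gcongr
        have h1 := hlt b hb.1 hb.2
        have h2 : (t₀ : ℝ) ≤ t := by exact_mod_cast ht
        nlinarith
  rw [tsum_zero] at hlim
  filter_upwards [hlim.eventually (ge_mem_nhds (by norm_num : (0 : ℝ) < 1 / 2))] with t ht
  have h1 : ∀ b, ‖vc f b - (Pi.single a 1 : _ → ℂ) b‖ * Real.exp (-(t * wt φ τ b)) =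
      F t b * Real.exp (-(t * wt φ τ a)) := fun b => by
    simp only [F]
    rw [mul_assoc, ← Real.exp_add]
    ring_nf
  rw [tsum_congr h1, tsum_mul_right]
  gcongr

/-! ### Division with convergence -/

open Classical in
/-- The coefficients of `x^β g`. -/
def shiftCoeff {n : ℕ} {ι : Type*} (g : ι → ConvSeries n) (β : Fin n →₀ ℕ)
    (b : ι × (Fin n →₀ ℕ)) : ℂ :=
  if β ≤ b.2 then vc g (b.1, b.2 - β) else 0

theorem shiftCoeff_add {n : ℕ} {ι : Type*} (g : ι → ConvSeries n) (β : Fin n →₀ ℕ) (j : ι)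
    (α : Fin n →₀ ℕ) : shiftCoeff g β (j, α + β) = vc g (j, α) := by
  simp [shiftCoeff]

theorem exists_eq_add_or_shiftCoeff_eq_zero {n : ℕ} {ι : Type*} (g : ι → ConvSeries n)
    (β : Fin n →₀ ℕ) (b : ι × (Fin n →₀ ℕ)) :
    (∃ α, b = (b.1, α + β)) ∨ shiftCoeff g β b = 0 := by
  by_cases h : β ≤ b.2
  · exact Or.inl ⟨b.2 - β, Prod.ext rfl (tsub_add_cancel_of_le h).symm⟩
  · exact Or.inr (if_neg h)

open Classical in
/-- Multiplication by `x^β` scales the weighted `ℓ¹` distance to the leading monomial, so that an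
estimate for `g` holds for all the `x^β g`. -/
theorem hasSum_shiftCoeff {n : ℕ} {ι : Type*} (φ : (Fin n →₀ ℕ) →+ ℝ) (τ : ι → ℝ) (t : ℝ)
    (g : ι → ConvSeries n) (p : ι × (Fin n →₀ ℕ)) (β : Fin n →₀ ℕ) {S : ℝ}
    (h : HasSum (fun b => ‖vc g b - (Pi.single p 1 : _ → ℂ) b‖ * Real.exp (-(t * wt φ τ b))) S) :
    HasSum (fun b => ‖shiftCoeff g β b - (Pi.single (p.1, p.2 + β) 1 : _ → ℂ) b‖ *
      Real.exp (-(t * wt φ τ b))) (S * Real.exp (-(t * φ β))) := by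
  have hinj : Function.Injective fun b : ι × (Fin n →₀ ℕ) => (b.1, b.2 + β) := by
    rintro ⟨i, α⟩ ⟨j, γ⟩ h
    simp only [Prod.mk.injEq, add_left_inj] at h
    exact Prod.ext h.1 h.2
  refine (hinj.hasSum_iff ?_).mp ?_
  · intro b hb
    rcases exists_eq_add_or_shiftCoeff_eq_zero g β b with ⟨α, hα⟩ | h0
    · exact absurd ⟨(b.1, α), hα.symm⟩ hb
    · rw [h0, Pi.single_eq_of_ne, sub_zero, norm_zero, zero_mul]
      rintro rfl
      exact hb ⟨p, rfl⟩
  · refine (h.mul_right (Real.exp (-(t * φ β)))).congr_fun fun b => ?_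
    obtain ⟨j, α⟩ := b
    have h1 : (Pi.single (p.1, p.2 + β) 1 : _ → ℂ) (j, α + β) = (Pi.single p 1 : _ → ℂ) (j, α) := by
      simp only [Pi.single_apply, Prod.ext_iff, add_left_inj]
    rw [Function.comp_apply, shiftCoeff_add, h1, wt_add, mul_assoc, ← Real.exp_add]
    ring_nf

/-- Division by finitely many vectors `gen p`, `p ∈ A`, with leading monomials `p` for the single
weight `wt φ τ`. A monomial `a ∈ E` is to be cancelled by means of `gen (base a)`. -/
theorem exists_division {n : ℕ} {ι : Type*} [Finite ι] {φ : (Fin n →₀ ℕ) →+ ℝ} {c : ℝ}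
    (hc : 0 < c) (hφ : ∀ α, c * α.degree ≤ φ α) (τ : ι → ℝ) (A : Finset (ι × (Fin n →₀ ℕ)))
    (gen : ι × (Fin n →₀ ℕ) → ι → ConvSeries n) (hgen : ∀ p ∈ A, vc (gen p) p = 1)
    (hlt : ∀ p ∈ A, ∀ b, vc (gen p) b ≠ 0 → b ≠ p → wt φ τ p < wt φ τ b)
    (E : Set (ι × (Fin n →₀ ℕ))) (base : ι × (Fin n →₀ ℕ) → ι × (Fin n →₀ ℕ))
    (hbase : ∀ a ∈ E, base a ∈ A ∧ ∃ β, a = ((base a).1, (base a).2 + β))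
    (B : Set (ι × (Fin n →₀ ℕ))) (hEB : E ⊆ B)
    (hB : ∀ a ∈ E, ∀ b ∉ B, shiftCoeff (gen (base a)) (a.2 - (base a).2) b = 0)
    (f : ι → ConvSeries n) (hf : ∀ b ∉ B, vc f b = 0) :
    ∃ (r : ι → ConvSeries n) (q : ι × (Fin n →₀ ℕ) → ConvSeries n),
      f = r + ∑ p ∈ A, q p • gen p ∧ (∀ b ∈ E, vc r b = 0) ∧ ∀ b ∉ B, vc r b = 0 := by
  classical
  obtain ⟨t, hft, hA, hA'⟩ := ((eventually_summable_vc hc hφ τ f).and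
    (((Filter.eventually_all_finset A).mpr fun p _ => eventually_summable_vc hc hφ τ (gen p)).and
    ((Filter.eventually_all_finset A).mpr fun p hp =>
      eventually_tsum_le_half hc hφ τ (hgen p hp) (hlt p hp)))).exists
  set W : ι × (Fin n →₀ ℕ) → ℝ := fun b => Real.exp (-(t * wt φ τ b)) with hWdef
  have hW : ∀ b, 0 < W b := fun b => Real.exp_pos _
  have hWadd : ∀ j α β, W (j, α + β) = W (j, α) * Real.exp (-(t * φ β)) := fun j α β => by
    simp only [hWdef, wt_add, ← Real.exp_add]
    ring_nf
  -- the column `a` is the tail of the multiple of `gen (base a)` with leading monomial `a`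
  let h : ι × (Fin n →₀ ℕ) → ι × (Fin n →₀ ℕ) → ℂ := fun a b =>
    if a ∈ E then shiftCoeff (gen (base a)) (a.2 - (base a).2) b - (Pi.single a 1 : _ → ℂ) b else 0
  have hsub : ∀ a ∈ E, a = ((base a).1, (base a).2 + (a.2 - (base a).2)) := fun a ha => by
    obtain ⟨β, hβ⟩ := (hbase a ha).2
    have : a.2 - (base a).2 = β := by
      rw [show a.2 = (base a).2 + β from congrArg Prod.snd hβ, add_tsub_cancel_left]
    rw [this]
    exact hβ
  have hsum : ∀ p ∈ A, Summable fun b => ‖vc (gen p) b - (Pi.single p 1 : _ → ℂ) b‖ * W b := by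
    intro p hp
    refine ((hA p hp).add (summable_of_ne_finset_zero (s := {p})
      (f := fun b => ‖(Pi.single p 1 : _ → ℂ) b‖ * W b) fun b hb => ?_)).of_nonneg_of_le
      (fun b => by positivity) fun b => ?_
    · rw [Pi.single_eq_of_ne (by simpa using hb), norm_zero, zero_mul]
    · rw [← add_mul]
      exact mul_le_mul_of_nonneg_right (norm_sub_le _ _) (hW b).le
  have hcol : ∀ a, ∃ S ≤ 1 / 2 * W a, HasSum (fun b => ‖h a b‖ * W b) S := by
    intro a
    by_cases ha : a ∈ E
    · have H := hasSum_shiftCoeff φ τ t (gen (base a)) (base a) (a.2 - (base a).2)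
        (hsum _ (hbase a ha).1).hasSum
      rw [← hsub a ha] at H
      refine ⟨_, ?_, by simpa only [h, if_pos ha] using H⟩
      conv_rhs => rw [hsub a ha, hWadd, ← mul_assoc]
      exact mul_le_mul_of_nonneg_right (hA' _ (hbase a ha).1) (Real.exp_pos _).le
    · refine ⟨0, by have := hW a; positivity, ?_⟩
      simp only [h, if_neg ha, norm_zero, zero_mul]
      exact hasSum_zero
  obtain ⟨u, hu, hfu⟩ := exists_eq_add_tsum W hW h (fun a => (hcol a).choose_spec.2.summable)
    (fun a => (hcol a).choose_spec.2.tsum_eq.trans_le (hcol a).choose_spec.1) (vc f) hft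
  have hconv : ∀ (j : ι) (δ : Fin n →₀ ℕ) (v : MvPowerSeries (Fin n) ℂ),
      (∀ α, MvPowerSeries.coeff α v = 0 ∨ MvPowerSeries.coeff α v = u (j, δ + α)) →
      v ∈ convergentSeries n := by
    intro j δ v hv
    refine mem_convergentSeries_of_summable φ (Nat.cast_nonneg t) v ?_
    have hinj : Function.Injective fun α : Fin n →₀ ℕ => (j, δ + α) := fun α β h => by
      simpa using h
    refine ((hu.comp_injective hinj).mul_right (W (j, δ))⁻¹).of_nonneg_of_le
      (fun α => by positivity) fun α => ?_
    simp only [Function.comp_apply]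
    rw [hWadd, mul_assoc, mul_right_comm, mul_inv_cancel₀ (hW _).ne', one_mul]
    rcases hv α with h0 | h0 <;> rw [h0]
    · rw [norm_zero, zero_mul]
      positivity
  let r : ι → ConvSeries n := fun j => ConvSeries.mk
    (fun α => if (j, α) ∈ E then 0 else u (j, α)) (hconv j 0 _ fun α => by
      change (if (j, α) ∈ E then 0 else u (j, α)) = 0 ∨ _ = _
      rw [zero_add]
      exact ite_eq_or_eq _ _ _)
  let q : ι × (Fin n →₀ ℕ) → ConvSeries n := fun p => ConvSeries.mk
    (fun β => if (p.1, p.2 + β) ∈ E ∧ base (p.1, p.2 + β) = p then u (p.1, p.2 + β) else 0)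
    (hconv p.1 p.2 _ fun α => (ite_eq_or_eq _ _ _).symm)
  have hr : ∀ b, vc r b = if b ∈ E then 0 else u b := fun b => rfl
  have hq : ∀ p β, MvPowerSeries.coeff β (q p).toSeries =
    if (p.1, p.2 + β) ∈ E ∧ base (p.1, p.2 + β) = p then u (p.1, p.2 + β) else 0 := fun p β => rfl
  have huB : ∀ b ∉ B, u b = 0 := by
    intro b hb
    have h1 := hfu b
    rw [hf b hb, tsum_congr (g := fun _ => (0 : ℂ)), tsum_zero, add_zero] at h1
    · exact h1.symm
    · intro a
      by_cases ha : a ∈ E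
      · simp only [h, if_pos ha, hB a ha b hb]
        rw [Pi.single_eq_of_ne, sub_zero, mul_zero]
        rintro rfl
        exact hb (hEB ha)
      · simp only [h, if_neg ha, mul_zero]
  refine ⟨r, q, vc_ext fun b => ?_, fun b hb => by rw [hr, if_pos hb], fun b hb => by
    rw [hr, huB b hb, ite_self]⟩
  -- only finitely many columns contribute to a given coefficient
  let k : ι × (Fin n →₀ ℕ) → ℂ := fun a =>
    if a ∈ E then u a * shiftCoeff (gen (base a)) (a.2 - (base a).2) b else 0
  let F : Finset (ι × (Fin n →₀ ℕ)) :=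
    (A ×ˢ Finset.HasAntidiagonal.antidiagonal b.2).image fun x => (x.1.1, x.1.2 + x.2.1)
  have hkE : ∀ a, k a ≠ 0 → a ∈ E ∧ a.2 - (base a).2 ≤ b.2 := by
    intro a ha
    by_cases haE : a ∈ E
    · refine ⟨haE, ?_⟩
      by_contra hle
      apply ha
      simp only [k, if_pos haE, shiftCoeff, if_neg hle, mul_zero]
    · exact absurd (if_neg haE) ha
  have hkF : ∀ a, k a ≠ 0 → a ∈ F := by
    intro a ha
    obtain ⟨haE, hle⟩ := hkE a ha
    refine Finset.mem_image.mpr ⟨(base a, (a.2 - (base a).2, b.2 - (a.2 - (base a).2))), ?_,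
      (hsub a haE).symm⟩
    simp [(hbase a haE).1, add_tsub_cancel_of_le hle]
  have hk : ∀ a ∉ F, k a = 0 := fun a ha => by
    by_contra h0
    exact ha (hkF a h0)
  have hd : ∀ a ∉ ({b} : Finset _), (if a ∈ E then u a * (Pi.single a 1 : _ → ℂ) b else 0) = 0 := by
    intro a ha
    rw [Pi.single_eq_of_ne (by simpa [eq_comm] using ha), mul_zero, ite_self]
  have hT : ∑' a, u a * h a b = ∑' a, k a - if b ∈ E then u b else 0 := by
    have h1 : ∀ a, u a * h a b = k a - if a ∈ E then u a * (Pi.single a 1 : _ → ℂ) b else 0 := by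
      intro a
      by_cases ha : a ∈ E
      · simp only [h, k, if_pos ha, mul_sub]
      · simp only [h, k, if_neg ha, mul_zero, sub_zero]
    rw [tsum_congr h1, (summable_of_ne_finset_zero hk).tsum_sub (summable_of_ne_finset_zero hd),
      tsum_eq_sum hd, Finset.sum_singleton, Pi.single_eq_same, mul_one]
  have hK : ∑' a, k a = ∑ x ∈ A ×ˢ Finset.HasAntidiagonal.antidiagonal b.2,
      MvPowerSeries.coeff x.2.1 (q x.1).toSeries * vc (gen x.1) (b.1, x.2.2) := by
    rw [tsum_eq_sum hk]
    symm
    have hval : ∀ x ∈ A ×ˢ Finset.HasAntidiagonal.antidiagonal b.2,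
        MvPowerSeries.coeff x.2.1 (q x.1).toSeries * vc (gen x.1) (b.1, x.2.2) ≠ 0 →
        ((x.1.1, x.1.2 + x.2.1) ∈ E ∧ base (x.1.1, x.1.2 + x.2.1) = x.1) ∧
        MvPowerSeries.coeff x.2.1 (q x.1).toSeries * vc (gen x.1) (b.1, x.2.2) =
          k (x.1.1, x.1.2 + x.2.1) := by
      intro x hx h0
      have hc : (x.1.1, x.1.2 + x.2.1) ∈ E ∧ base (x.1.1, x.1.2 + x.2.1) = x.1 := by
        by_contra hc
        apply h0
        rw [hq, if_neg hc, zero_mul]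
      refine ⟨hc, ?_⟩
      have hx2 : x.2.1 + x.2.2 = b.2 :=
        Finset.HasAntidiagonal.mem_antidiagonal.mp (Finset.mem_product.mp hx).2
      have hsh : shiftCoeff (gen x.1) x.2.1 b = vc (gen x.1) (b.1, x.2.2) := by
        rw [← shiftCoeff_add, add_comm, hx2]
      simp only [k, if_pos hc.1, hc.2, add_tsub_cancel_left, hsh, hq, and_true]
    refine Finset.sum_bij_ne_zero (fun x _ _ => (x.1.1, x.1.2 + x.2.1)) ?_ ?_ ?_ ?_
    · intro x hx h0
      exact Finset.mem_image.mpr ⟨x, hx, rfl⟩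
    · intro x hx h0 y hy h0' hxy
      have h1 : x.1 = y.1 := by
        rw [← (hval x hx h0).1.2, hxy, (hval y hy h0').1.2]
      have h2 : x.2.1 = y.2.1 := by
        have := congrArg Prod.snd hxy
        simpa [h1] using this
      have h3 : x.2.2 = y.2.2 := by
        have hx2 := Finset.HasAntidiagonal.mem_antidiagonal.mp (Finset.mem_product.mp hx).2
        have hy2 := Finset.HasAntidiagonal.mem_antidiagonal.mp (Finset.mem_product.mp hy).2
        rw [← hy2, h2] at hx2
        exact add_left_cancel hx2
      exact Prod.ext h1 (Prod.ext h2 h3)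
    · intro a _ ha
      obtain ⟨haE, hle⟩ := hkE a ha
      have hmem : (base a, (a.2 - (base a).2, b.2 - (a.2 - (base a).2))) ∈
          A ×ˢ Finset.HasAntidiagonal.antidiagonal b.2 := by
        simp [(hbase a haE).1, add_tsub_cancel_of_le hle]
      refine ⟨_, hmem, ?_, (hsub a haE).symm⟩
      simp only [hq, ← hsub a haE, haE, true_and, if_true]
      simpa only [k, if_pos haE, shiftCoeff, if_pos hle] using ha
    · intro x hx h0
      exact (hval x hx h0).2
  rw [hfu b, hT, hK, vc_add, vc_sum, hr, Finset.sum_product]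
  have hs : ∀ p ∈ A, vc (q p • gen p) b = ∑ x ∈ Finset.HasAntidiagonal.antidiagonal b.2,
      MvPowerSeries.coeff x.1 (q p).toSeries * vc (gen p) (b.1, x.2) := fun p _ =>
    vc_series_smul _ _ _ _
  rw [Finset.sum_congr rfl hs]
  split_ifs <;> ring

/-- Division by `N`: every vector is congruent modulo `N` to one none of whose monomials is the
leading monomial of an element of `N`, and division does not decrease the level `ℓ`. -/
theorem exists_remainder {n : ℕ} {ι : Type*} [Finite ι] {φ ψ : (Fin n →₀ ℕ) →+ ℝ} {c : ℝ}
    (hφ : ∀ α, 0 ≤ φ α) (hc : 0 < c) (hψ : ∀ α, c * α.degree ≤ ψ α) (τ σ : ι → ℝ)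
    (N : Submodule (ConvSeries n) (ι → ConvSeries n)) (f : ι → ConvSeries n) (d : ℝ)
    (hf : ∀ b, vc f b ≠ 0 → d ≤ wt φ τ b) :
    ∃ r, f - r ∈ N ∧ (∀ b ∈ leadSet (wt φ τ) (wt ψ σ) N, vc r b = 0) ∧
      ∀ b, vc r b ≠ 0 → d ≤ wt φ τ b := by
  classical
  have hψ0 : ∀ α, 0 ≤ ψ α := fun α => (by positivity : (0 : ℝ) ≤ c * α.degree).trans (hψ α)
  set E := leadSet (wt φ τ) (wt ψ σ) N with hE
  have hgen : ∀ p, ∃ g : ι → ConvSeries n, p ∈ E →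
      g ∈ N ∧ vc g p = 1 ∧ IsLead (wt φ τ) (wt ψ σ) g p := by
    intro p
    by_cases hp : p ∈ E
    · obtain ⟨g, hg, hgp⟩ := hp
      have h1 : vc ((vc g p)⁻¹ • g) p = 1 := by rw [vc_smul, inv_mul_cancel₀ hgp.1]
      refine ⟨(vc g p)⁻¹ • g, fun _ => ⟨?_, h1, ?_, fun b hb => hgp.2 b fun h0 => hb ?_⟩⟩
      · have h2 : (vc g p)⁻¹ • g = algebraMap ℂ (ConvSeries n) (vc g p)⁻¹ • g := by
          funext j
          exact Algebra.smul_def (vc g p)⁻¹ (g j)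
        rw [h2]
        exact N.smul_mem _ hg
      · rw [h1]
        exact one_ne_zero
      · rw [vc_smul, h0, mul_zero]
    · exact ⟨0, fun h => absurd h hp⟩
  choose gen hgen using hgen
  choose T hTE hT using fun j => exists_finset_forall_exists_le {α | (j, α) ∈ E}
  have hfin : {b : ι × (Fin n →₀ ℕ) | b.2 ∈ T b.1}.Finite := by
    have : {b : ι × (Fin n →₀ ℕ) | b.2 ∈ T b.1} ⊆ ⋃ j, Prod.mk j '' (T j : Set (Fin n →₀ ℕ)) :=
      fun b hb => Set.mem_iUnion.mpr ⟨b.1, b.2, hb, rfl⟩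
    exact (Set.finite_iUnion fun j => (T j).finite_toSet.image _).subset this
  let A := hfin.toFinset
  have hAE : ∀ p ∈ A, p ∈ E := fun p hp => hTE p.1 (hfin.mem_toFinset.mp hp)
  have hbase : ∀ a, ∃ p, a ∈ E → p ∈ A ∧ ∃ β, a = (p.1, p.2 + β) := by
    intro a
    by_cases ha : a ∈ E
    · obtain ⟨s, hs, hle⟩ := hT a.1 a.2 ha
      obtain ⟨β, hβ⟩ := exists_add_of_le hle
      exact ⟨(a.1, s), fun _ => ⟨hfin.mem_toFinset.mpr hs, β, Prod.ext rfl hβ⟩⟩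
    · exact ⟨a, fun h => absurd h ha⟩
  choose base hbase using hbase
  -- a single weight for which all the generators have the expected leading monomials
  obtain ⟨M, hM⟩ := ((Filter.eventually_all_finset A).mpr fun p hp =>
    (hgen p (hAE p hp)).2.2.eventually_lt hφ hψ0).exists
  have hwt : ∀ b, wt (ψ + M • φ) (fun j => σ j + M * τ j) b = wt ψ σ b + M * wt φ τ b := by
    intro b
    simp only [wt, AddMonoidHom.add_apply, AddMonoidHom.nsmul_apply, nsmul_eq_mul]
    ring
  obtain ⟨r, q, hfr, hrE, hrB⟩ := exists_division hc (φ := ψ + M • φ)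
    (fun α => (hψ α).trans (by
      have := hφ α
      simp only [AddMonoidHom.add_apply, AddMonoidHom.nsmul_apply, nsmul_eq_mul]
      exact le_add_of_nonneg_right (by positivity)))
    (fun j => σ j + M * τ j) A gen (fun p hp => (hgen p (hAE p hp)).2.1)
    (fun p hp b hb hbp => by
      rw [hwt, hwt]
      exact hM p hp b hb hbp)
    (E ∩ {a | d ≤ wt φ τ a}) base (fun a ha => hbase a ha.1) {a | d ≤ wt φ τ a}
    Set.inter_subset_right
    (fun a ha b hb => by
      obtain ⟨hpA, β, hβ⟩ := hbase a ha.1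
      have h1 : a.2 - (base a).2 = β := by
        rw [show a.2 = (base a).2 + β from congrArg Prod.snd hβ, add_tsub_cancel_left]
      rw [h1]
      by_contra h0
      rcases exists_eq_add_or_shiftCoeff_eq_zero (gen (base a)) β b with ⟨α, hα⟩ | h2
      · rw [hα, shiftCoeff_add] at h0
        have h3 : wt φ τ (base a) ≤ wt φ τ (b.1, α) := by
          by_cases heq : (b.1, α) = base a
          · rw [heq]
          · rcases (hgen _ (hAE _ hpA)).2.2.2 _ h0 heq with h | h
            · exact h.le
            · exact h.1.le
        apply hb
        have h4 : d ≤ wt φ τ a := ha.2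
        rw [hβ, wt_add] at h4
        change d ≤ wt φ τ b
        rw [hα, wt_add]
        linarith
      · exact h0 h2)
    f (fun b hb => by
      by_contra h0
      exact hb (hf b h0))
  refine ⟨r, ?_, fun b hb => ?_, fun b hb => ?_⟩
  · rw [sub_eq_of_eq_add' hfr]
    exact N.sum_mem fun p hp => N.smul_mem _ (hgen p (hAE p hp)).1
  · by_cases h : d ≤ wt φ τ b
    · exact hrE b ⟨hb, h⟩
    · exact hrB b h
  · by_contra h
    exact hb (hrB b h)

/-- Uniqueness of remainders. -/
theorem eq_zero_of_mem_of_leadSet {n : ℕ} {ι : Type*} [Finite ι] {φ ψ : (Fin n →₀ ℕ) →+ ℝ}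
    (hφ : ∀ α, 0 ≤ φ α) (hψ : ∀ α, 0 ≤ ψ α) {τ σ : ι → ℝ} (hinj : Function.Injective (wt ψ σ))
    {N : Submodule (ConvSeries n) (ι → ConvSeries n)} {f : ι → ConvSeries n} (hf : f ∈ N)
    (hE : ∀ b ∈ leadSet (wt φ τ) (wt ψ σ) N, vc f b = 0) : f = 0 := by
  by_contra h0
  obtain ⟨a, ha⟩ := exists_isLead hφ hψ τ σ hinj h0
  exact ha.1 (hE a ⟨f, hf, ha⟩)

/-! ### Normal forms and the order filtration -/

theorem normalForm_eq_iff {n : ℕ} {P : D n} {p : (Fin n →₀ ℕ) →₀ ConvSeries n} :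
    normalForm n P = p ↔ opOf n p = P.toEnd := by
  rw [← opOf_normalForm]
  exact ⟨fun h => by rw [h], fun h => (opOf_injective n h).symm⟩

theorem normalForm_ofSeries_mul {n : ℕ} (a : ConvSeries n) (P : D n) (β : Fin n →₀ ℕ) :
    normalForm n (D.ofSeries a * P) β = a * normalForm n P β := by
  have h : normalForm n (D.ofSeries a * P) =
      (normalForm n P).mapRange (a * ·) (mul_zero a) := by
    rw [normalForm_eq_iff, map_mul, ← opOf_normalForm P]
    change _ = mulOp a * _
    induction normalForm n P using Finsupp.induction_linear with
    | zero => simp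
    | add p q hp hq =>
      rw [Finsupp.mapRange_add (by simp [mul_add]), map_add, map_add, hp, hq, mul_add]
    | single β b =>
      rw [Finsupp.mapRange_single, opOf_single, opOf_single, ← mul_assoc]
      congr 1
      exact LinearMap.ext fun f => mul_assoc a b f
  rw [h, Finsupp.mapRange_apply]

theorem normalForm_partial_mul {n : ℕ} (i : Fin n) (P : D n) :
    normalForm n (D.partial i * P) =
      (normalForm n P).mapDomain (· + Finsupp.single i 1) +
        (normalForm n P).mapRange (partialOp i) (map_zero _) := by
  rw [normalForm_eq_iff, map_mul, ← opOf_normalForm P]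
  change _ = partialOp i * _
  induction normalForm n P using Finsupp.induction_linear with
  | zero => simp
  | add p q hp hq =>
    rw [Finsupp.mapRange_add (by simp), Finsupp.mapDomain_add, add_add_add_comm, map_add, hp, hq,
      map_add, mul_add]
  | single β b =>
    rw [Finsupp.mapRange_single, Finsupp.mapDomain_single, map_add, opOf_single, opOf_single,
      opOf_single, partialPow_add_single, ← mul_assoc, ← add_mul, ← partialOp_mul_mulOp, mul_assoc]

theorem opOrder_le_iff {n : ℕ} {P : D n} {e : ℕ} :
    opOrder P ≤ e ↔ ∀ β, normalForm n P β ≠ 0 → β.degree ≤ e := by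
  simp [opOrder, Finset.sup_le_iff]

theorem opOrder_zero {n : ℕ} : opOrder (0 : D n) = 0 := by simp [opOrder]

theorem opOrder_add_le {n : ℕ} {P Q : D n} {e : ℕ} (hP : opOrder P ≤ e) (hQ : opOrder Q ≤ e) :
    opOrder (P + Q) ≤ e := by
  rw [opOrder_le_iff] at *
  intro β hβ
  by_cases h : normalForm n P β = 0
  · exact hQ β fun h' => hβ (by simp [h, h'])
  · exact hP β h

theorem opOrder_ofSeries_mul_le {n : ℕ} (a : ConvSeries n) {P : D n} {e : ℕ}
    (hP : opOrder P ≤ e) : opOrder (D.ofSeries a * P) ≤ e := by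
  rw [opOrder_le_iff] at *
  intro β hβ
  refine hP β fun h => hβ ?_
  rw [normalForm_ofSeries_mul, h, mul_zero]

theorem opOrder_smul_le {n : ℕ} (c : ℂ) {P : D n} {e : ℕ}
    (hP : opOrder P ≤ e) : opOrder (c • P) ≤ e := by
  rw [opOrder_le_iff] at *
  intro β hβ
  refine hP β fun h => hβ ?_
  rw [map_smul, Finsupp.smul_apply, h, smul_zero]

theorem opOrder_partial_mul_le {n : ℕ} (i : Fin n) {P : D n} {e : ℕ}
    (hP : opOrder P ≤ e) : opOrder (D.partial i * P) ≤ e + 1 := by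
  classical
  rw [opOrder_le_iff] at *
  intro β hβ
  rw [normalForm_partial_mul, Finsupp.add_apply] at hβ
  by_cases h : (normalForm n P).mapDomain (· + Finsupp.single i 1) β = 0
  · rw [h, zero_add, Finsupp.mapRange_apply] at hβ
    exact (hP β fun h' => hβ (by rw [h', map_zero])).trans (Nat.le_succ e)
  · obtain ⟨γ, hγ, rfl⟩ := Finset.mem_image.mp
      (Finsupp.mapDomain_support (Finsupp.mem_support_iff.mpr h))
    rw [map_add, Finsupp.degree_single]
    exact Nat.succ_le_succ (hP γ (Finsupp.mem_support_iff.mp hγ))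

/-! ### The homogenized module -/

theorem monomial_mem_homogModule {n r : ℕ} (N : Submodule (D n) (Fin r → D n)) {P : Fin r → D n}
    (hP : P ∈ N) {e : ℕ} (he : ∀ j, opOrder (P j) ≤ e) :
    (fun j => Polynomial.monomial e (P j)) ∈ homogModule N := by
  let X : homogRing n := ⟨Polynomial.X, Algebra.subset_adjoin (Or.inr rfl)⟩
  have hd : (Finset.univ.sup fun i => opOrder (P i)) ≤ e := Finset.sup_le fun i _ => he i
  have h : (fun j => Polynomial.monomial e (P j)) =
      X ^ (e - Finset.univ.sup fun i => opOrder (P i)) • homogenize P := by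
    funext j
    change _ = Polynomial.X ^ (e - Finset.univ.sup fun i => opOrder (P i)) *
      Polynomial.monomial _ (P j)
    rw [Polynomial.X_pow_mul, Polynomial.monomial_mul_X_pow, add_tsub_cancel_of_le hd]
  rw [h]
  exact Submodule.smul_mem _ _ (Submodule.subset_span ⟨P, hP, rfl⟩)

/-- The homogeneous components of the elements of `h(N)` are given by elements of `N`. -/
theorem coeff_mem_of_mem_homogModule {n r : ℕ} {N : Submodule (D n) (Fin r → D n)}
    {G : Fin r → Polynomial (D n)} (hG : G ∈ homogModule N) (e : ℕ) :
    (fun j => (G j).coeff e) ∈ N ∧ ∀ j, opOrder ((G j).coeff e) ≤ e := by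
  let S : Submodule (homogRing n) (Fin r → Polynomial (D n)) :=
    { carrier := {G | ∀ e, (fun j => (G j).coeff e) ∈ N ∧ ∀ j, opOrder ((G j).coeff e) ≤ e}
      zero_mem' := fun e => ⟨by
        simp only [Pi.zero_apply, Polynomial.coeff_zero]
        exact N.zero_mem, fun j => by simp [opOrder_zero]⟩
      add_mem' := fun {F G} hF hG e => ⟨by
        simp only [Pi.add_apply, Polynomial.coeff_add]
        exact N.add_mem (hF e).1 (hG e).1, fun j => by
        simp only [Pi.add_apply, Polynomial.coeff_add]
        exact opOrder_add_le ((hF e).2 j) ((hG e).2 j)⟩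
      smul_mem' := by
        rintro ⟨a, ha⟩ G hG
        change ∀ e, (fun j => (a * G j).coeff e) ∈ N ∧ ∀ j, opOrder ((a * G j).coeff e) ≤ e
        induction ha using Algebra.adjoin_induction generalizing G with
        | mem a ha =>
          rcases ha with (⟨b, rfl⟩ | ⟨i, rfl⟩) | rfl
          · intro e
            simp only [Polynomial.coeff_C_mul]
            exact ⟨N.smul_mem (D.ofSeries b) (hG e).1,
              fun j => opOrder_ofSeries_mul_le b ((hG e).2 j)⟩
          · intro e
            rcases e with _ | e
            · simp only [← Polynomial.C_mul_X_pow_eq_monomial, pow_one, mul_assoc,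
                Polynomial.coeff_C_mul, Polynomial.X_mul, Polynomial.coeff_mul_X_zero, mul_zero]
              exact ⟨N.zero_mem, fun j => opOrder_zero.le⟩
            · simp only [← Polynomial.C_mul_X_pow_eq_monomial, pow_one, mul_assoc,
                Polynomial.coeff_C_mul, Polynomial.X_mul, Polynomial.coeff_mul_X]
              exact ⟨N.smul_mem (D.partial i) (hG e).1,
                fun j => opOrder_partial_mul_le i ((hG e).2 j)⟩
          · intro e
            rcases e with _ | e
            · simp only [Polynomial.X_mul, Polynomial.coeff_mul_X_zero]
              exact ⟨N.zero_mem, fun j => opOrder_zero.le⟩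
            · simp only [Polynomial.X_mul, Polynomial.coeff_mul_X]
              exact ⟨(hG e).1, fun j => ((hG e).2 j).trans (Nat.le_succ e)⟩
        | algebraMap c =>
          intro e
          simp only [← Algebra.smul_def, Polynomial.coeff_smul]
          refine ⟨?_, fun j => opOrder_smul_le c ((hG e).2 j)⟩
          have h := N.smul_mem (algebraMap ℂ (D n) c) (hG e).1
          have h' : (fun j => c • (G j).coeff e) =
              algebraMap ℂ (D n) c • fun j => (G j).coeff e :=
            funext fun j => Algebra.smul_def c _
          rwa [h']
        | add a b _ _ iha ihb =>
          intro e
          simp only [add_mul, Polynomial.coeff_add]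
          exact ⟨N.add_mem (iha hG e).1 (ihb hG e).1,
            fun j => opOrder_add_le ((iha hG e).2 j) ((ihb hG e).2 j)⟩
        | mul a b _ _ iha ihb =>
          simp only [mul_assoc]
          exact iha (ihb hG) }
  have hle : homogModule N ≤ S := by
    refine Submodule.span_le.mpr ?_
    rintro _ ⟨P, hP, rfl⟩ e
    simp only [homogenize, Polynomial.coeff_monomial]
    split_ifs with h
    · exact ⟨hP, fun j => h ▸ Finset.le_sup (f := fun i => opOrder (P i)) (Finset.mem_univ j)⟩
    · exact ⟨N.zero_mem, fun j => opOrder_zero.le.trans (Nat.zero_le _)⟩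
  exact hle hG e

/-! ### Vectors of operators of bounded order -/

/-- Indices `(j, β)` of the operators `∂^β ε_j` of order at most `e`. -/
abbrev OpIdx (n r e : ℕ) : Type := {x : Fin r × (Fin n →₀ ℕ) // x.2.degree ≤ e}

theorem finite_degree_le (n e : ℕ) : {β : Fin n →₀ ℕ | β.degree ≤ e}.Finite := by
  refine (Set.finite_Iic (Finsupp.equivFunOnFinite.symm fun _ => e)).subset fun β hβ i => ?_
  exact (Finsupp.le_degree i β).trans hβ

instance (n r e : ℕ) : Finite (OpIdx n r e) :=
  Set.Finite.to_subtype (s := {x : Fin r × (Fin n →₀ ℕ) | x.2.degree ≤ e}) <|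
    (Set.finite_univ.prod (finite_degree_le n e)).subset fun _ hx => ⟨trivial, hx⟩

/-- The vector of operators of order at most `e` with given coefficients. -/
def ofCoeffs {n r e : ℕ} : (OpIdx n r e → ConvSeries n) →ₗ[ℂ] (Fin r → D n) where
  toFun v j := (normalForm n).symm (Finsupp.ofSupportFinite
    (fun β => if h : β.degree ≤ e then v ⟨(j, β), h⟩ else 0) <|
      (finite_degree_le n e).subset fun β hβ => by
        by_contra h
        exact hβ (dif_neg h))
  map_add' v w := by
    funext j
    rw [Pi.add_apply, ← map_add]
    congr 1
    ext1 β
    simp only [Finsupp.ofSupportFinite_coe, Finsupp.add_apply]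
    split_ifs <;> simp
  map_smul' c v := by
    funext j
    rw [Pi.smul_apply, ← map_smul]
    congr 1
    ext1 β
    simp only [Finsupp.ofSupportFinite_coe, Finsupp.smul_apply]
    split_ifs <;> simp

theorem normalForm_ofCoeffs {n r e : ℕ} (v : OpIdx n r e → ConvSeries n) (j : Fin r)
    (β : Fin n →₀ ℕ) : normalForm n (ofCoeffs v j) β =
      if h : β.degree ≤ e then v ⟨(j, β), h⟩ else 0 := by
  change normalForm n ((normalForm n).symm _) β = _
  rw [LinearEquiv.apply_symm_apply]
  rfl

theorem opCoeff_ofCoeffs {n r e : ℕ} (v : OpIdx n r e → ConvSeries n) (x : OpIdx n r e)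
    (α : Fin n →₀ ℕ) : opCoeff (ofCoeffs v x.1.1) α x.1.2 = vc v (x, α) := by
  rw [opCoeff, normalForm_ofCoeffs, dif_pos x.2]
  rfl

theorem degree_le_of_opCoeff_ofCoeffs {n r e : ℕ} {v : OpIdx n r e → ConvSeries n} {j : Fin r}
    {α β : Fin n →₀ ℕ} (h : opCoeff (ofCoeffs v j) α β ≠ 0) : β.degree ≤ e := by
  by_contra h'
  apply h
  rw [opCoeff, normalForm_ofCoeffs, dif_neg h', map_zero, map_zero]

theorem opOrder_ofCoeffs_le {n r e : ℕ} (v : OpIdx n r e → ConvSeries n) (j : Fin r) :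
    opOrder (ofCoeffs v j) ≤ e := by
  rw [opOrder_le_iff]
  intro β hβ
  by_contra h
  exact hβ (by rw [normalForm_ofCoeffs, dif_neg h])

theorem exists_ofCoeffs_eq {n r e : ℕ} {P : Fin r → D n} (hP : ∀ j, opOrder (P j) ≤ e) :
    ∃ v : OpIdx n r e → ConvSeries n, ofCoeffs v = P := by
  refine ⟨fun x => normalForm n (P x.1.1) x.1.2, funext fun j => (normalForm n).injective ?_⟩
  ext1 β
  rw [normalForm_ofCoeffs]
  split_ifs with h
  · rfl
  · by_contra h'
    exact h (opOrder_le_iff.mp (hP j) β (Ne.symm h'))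

theorem ofCoeffs_series_smul {n r e : ℕ} (a : ConvSeries n) (v : OpIdx n r e → ConvSeries n) :
    ofCoeffs (a • v) = D.ofSeries a • ofCoeffs v := by
  funext j
  refine (normalForm n).injective (Finsupp.ext fun β => ?_)
  rw [Pi.smul_apply, smul_eq_mul, normalForm_ofSeries_mul, normalForm_ofCoeffs,
    normalForm_ofCoeffs]
  split_ifs <;> simp

/-- The elements of `N` of order at most `e`, as a submodule of a free `ℂ{x}`-module. -/
def boundedPart {n r : ℕ} (N : Submodule (D n) (Fin r → D n)) (e : ℕ) :
    Submodule (ConvSeries n) (OpIdx n r e → ConvSeries n) where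
  carrier := {v | ofCoeffs v ∈ N}
  zero_mem' := by
    change ofCoeffs 0 ∈ N
    rw [map_zero]
    exact N.zero_mem
  add_mem' {v w} hv hw := by
    change ofCoeffs (v + w) ∈ N
    rw [map_add]
    exact N.add_mem hv hw
  smul_mem' a v hv := by
    change ofCoeffs (a • v) ∈ N
    rw [ofCoeffs_series_smul]
    exact N.smul_mem _ hv

/-! ### Leading monomials and the graded modules -/

/-- The multidegree `β - α + m⁽ʲ⁾ ∈ ℤᵏ` of the monomial `x^α ∂^β ε_j`. -/
def multidegree {n k r e : ℕ} (hk : k ≤ n) (m : Fin r → Fin k → ℤ)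
    (b : OpIdx n r e × (Fin n →₀ ℕ)) (i : Fin k) : ℤ :=
  b.1.1.2 (Fin.castLE hk i) - b.2 (Fin.castLE hk i) + m b.1.1.1 i

/-- The linear form `α ↦ L(α₁,…,α_k)`. -/
def levelSlope {n k : ℕ} (hk : k ≤ n) (L : Fin k → ℚ) : (Fin n →₀ ℕ) →+ ℝ where
  toFun α := ∑ i, (L i : ℝ) * α (Fin.castLE hk i)
  map_zero' := by simp
  map_add' α β := by simp [mul_add, Finset.sum_add_distrib]

theorem levelSlope_nonneg {n k : ℕ} (hk : k ≤ n) {L : Fin k → ℚ} (hL : L ∈ nonnegForms k)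
    (α : Fin n →₀ ℕ) : 0 ≤ levelSlope hk L α := by
  change 0 ≤ ∑ i, (L i : ℝ) * (α (Fin.castLE hk i) : ℝ)
  exact Finset.sum_nonneg fun i _ => mul_nonneg (Rat.cast_nonneg.mpr (hL i)) (Nat.cast_nonneg _)

/-- The opposite of the `L`-degree, as a weight. -/
def level {n k r e : ℕ} (hk : k ≤ n) (m : Fin r → Fin k → ℤ) (L : Fin k → ℚ) :
    OpIdx n r e × (Fin n →₀ ℕ) → ℝ :=
  wt (levelSlope hk L) fun x =>
    -∑ i, (L i : ℝ) * ((x.1.2 (Fin.castLE hk i) : ℝ) + (m x.1.1 i : ℝ))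

theorem level_eq_sum {n k r e : ℕ} (hk : k ≤ n) (m : Fin r → Fin k → ℤ) (L : Fin k → ℚ)
    (b : OpIdx n r e × (Fin n →₀ ℕ)) :
    level hk m L b = -((∑ i, L i * (multidegree hk m b i : ℚ) : ℚ) : ℝ) := by
  push_cast
  simp only [level, wt, levelSlope, AddMonoidHom.coe_mk, ZeroHom.coe_mk, multidegree]
  rw [← Finset.sum_neg_distrib, ← Finset.sum_add_distrib, ← Finset.sum_neg_distrib]
  refine Finset.sum_congr rfl fun i _ => ?_
  push_cast
  ring

theorem level_eq_LDegree {n k r e : ℕ} (hk : k ≤ n) (m : Fin r → Fin k → ℤ) (L : Fin k → ℚ)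
    (b : OpIdx n r e × (Fin n →₀ ℕ)) :
    level hk m L b = -(LDegree hk m L (b.1.1.1, e, b.2, b.1.1.2) : ℝ) := by
  rw [level_eq_sum, LDegree]
  congr 2
  refine Finset.sum_congr rfl fun i _ => ?_
  rw [multidegree]
  push_cast
  ring

/-- The part of level `c` of an element of `gr^L(h(N))` in the homogeneous component `e` is the
initial part of an element of `N` of order at most `e`. -/
theorem exists_initial_part {n k r : ℕ} (hk : k ≤ n) (m : Fin r → Fin k → ℤ)
    {N : Submodule (D n) (Fin r → D n)} {L : Fin k → ℚ} {s : MonoIdx n r → ℂ}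
    (hs : s ∈ grL hk m (homogModule N) L) (e : ℕ) (c : ℝ) :
    ∃ v ∈ boundedPart N e, ∀ b, (vc v b ≠ 0 → c ≤ level hk m L b) ∧
      (level hk m L b = c → vc v b = s (b.1.1.1, e, b.2, b.1.1.2)) := by
  induction hs using Submodule.span_induction with
  | mem s hs =>
    obtain ⟨G, hG, d, hd, rfl⟩ := hs
    by_cases hcd : c = -(d : ℝ)
    · obtain ⟨hGN, hGe⟩ := coeff_mem_of_mem_homogModule hG e
      obtain ⟨v, hv⟩ := exists_ofCoeffs_eq hGe
      have hvc : ∀ b, vc v b = vecCoeff G (b.1.1.1, e, b.2, b.1.1.2) := fun b => by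
        rw [vecCoeff, ← opCoeff_ofCoeffs v b.1 b.2, hv]
      refine ⟨v, ?_, fun b => ⟨fun hb => ?_, fun hb => ?_⟩⟩
      · change ofCoeffs v ∈ N
        rw [hv]
        exact hGN
      · rw [hvc] at hb
        rw [level_eq_LDegree, hcd]
        have := hd _ hb
        have h' : (LDegree hk m L (b.1.1.1, e, b.2, b.1.1.2) : ℝ) ≤ d := by exact_mod_cast this
        linarith
      · rw [level_eq_LDegree, hcd, neg_inj] at hb
        rw [LSymbol, if_pos (by exact_mod_cast hb), hvc]
    · refine ⟨0, zero_mem _, fun b => ⟨fun hb => absurd (vc_zero b) hb, fun hb => ?_⟩⟩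
      rw [LSymbol, if_neg, vc_zero]
      intro h
      rw [level_eq_LDegree, h] at hb
      exact hcd hb.symm
  | zero =>
    exact ⟨0, zero_mem _, fun b => ⟨fun hb => absurd (vc_zero b) hb, fun _ => vc_zero b⟩⟩
  | add s t _ _ ihs iht =>
    obtain ⟨v, hv, hv'⟩ := ihs
    obtain ⟨w, hw, hw'⟩ := iht
    refine ⟨v + w, add_mem hv hw, fun b => ⟨fun hb => ?_, fun hb => ?_⟩⟩
    · by_cases h : vc v b = 0
      · exact (hw' b).1 fun h' => hb (by rw [vc_add, h, h', add_zero])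
      · exact (hv' b).1 h
    · rw [vc_add, (hv' b).2 hb, (hw' b).2 hb]
      rfl
  | smul z s _ ih =>
    obtain ⟨v, hv, hv'⟩ := ih
    refine ⟨z • v, ?_, fun b => ⟨fun hb => ?_, fun hb => ?_⟩⟩
    · have h2 : z • v = algebraMap ℂ (ConvSeries n) z • v :=
        funext fun j => Algebra.smul_def z (v j)
      rw [h2]
      exact Submodule.smul_mem _ _ hv
    · exact (hv' b).1 fun h => hb (by rw [vc_smul, h, mul_zero])
    · rw [vc_smul, (hv' b).2 hb]
      rfl

/-- The leading monomials of the elements of `N` of order at most `e` are determined by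
`gr^L(h(N))`. -/
theorem leadSet_subset_of_grL_eq {n k r : ℕ} (hk : k ≤ n) (m : Fin r → Fin k → ℤ)
    (N : Submodule (D n) (Fin r → D n)) {L L' : Fin k → ℚ}
    (h : grL hk m (homogModule N) L = grL hk m (homogModule N) L') (e : ℕ)
    (w : OpIdx n r e × (Fin n →₀ ℕ) → ℝ) :
    leadSet (level hk m L) w (boundedPart N e) ⊆ leadSet (level hk m L') w (boundedPart N e) := by
  classical
  rintro a ⟨f, hf, ha, hlt⟩
  let idx : OpIdx n r e × (Fin n →₀ ℕ) → MonoIdx n r := fun b => (b.1.1.1, e, b.2, b.1.1.2)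
  -- the `L`-symbol of `f` is a sum of `L'`-symbols of different degrees; the monomial `a` occurs
  -- in the one of degree `-level hk m L' a`, which has no monomials of smaller weight
  let G : Fin r → Polynomial (D n) := fun j => Polynomial.monomial e (ofCoeffs f j)
  have hG : G ∈ homogModule N := monomial_mem_homogModule N hf (opOrder_ofCoeffs_le f)
  have hGf : ∀ b, vecCoeff G (idx b) = vc f b := fun b => by
    simp only [vecCoeff, G, idx, Polynomial.coeff_monomial, if_true]
    exact opCoeff_ofCoeffs f b.1 b.2
  have hle : ∀ b, vc f b ≠ 0 → level hk m L a ≤ level hk m L b := fun b hb => by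
    by_cases hba : b = a
    · rw [hba]
    · rcases hlt b hb hba with h | h
      · exact h.le
      · exact h.1.le
  have hmem : LSymbol hk m L (LDegree hk m L (idx a)) G ∈ grL hk m (homogModule N) L := by
    refine Submodule.subset_span ⟨G, hG, _, ?_, rfl⟩
    rintro ⟨j, e', α, β⟩ hx
    have he : e = e' := by
      by_contra hne
      apply hx
      simp [vecCoeff, G, Polynomial.coeff_monomial, hne, opCoeff]
    subst he
    have hβ : β.degree ≤ e := by
      apply degree_le_of_opCoeff_ofCoeffs (v := f) (j := j) (α := α)
      simpa [vecCoeff, G, Polynomial.coeff_monomial] using hx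
    have h1 := hle (⟨(j, β), hβ⟩, α) (by rw [← hGf]; exact hx)
    rw [level_eq_LDegree, level_eq_LDegree, neg_le_neg_iff] at h1
    exact_mod_cast h1
  rw [h] at hmem
  obtain ⟨v, hv, hvb⟩ := exists_initial_part hk m hmem e (level hk m L' a)
  refine ⟨v, hv, ?_, fun b hb hba => ?_⟩
  · rw [(hvb a).2 rfl, LSymbol, if_pos rfl]
    exact (hGf a).trans_ne ha
  · rcases ((hvb b).1 hb).lt_or_eq with h1 | h1
    · exact Or.inl h1
    · refine Or.inr ⟨h1, ?_⟩
      rw [(hvb b).2 h1.symm, LSymbol] at hb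
      have h2 : LDegree hk m L (idx b) = LDegree hk m L (idx a) := by
        by_contra h2
        exact hb (if_neg h2)
      have h3 : vc f b ≠ 0 := by
        rw [if_pos h2] at hb
        rw [← hGf]
        exact hb
      rcases hlt b h3 hba with h4 | h4
      · rw [level_eq_LDegree, level_eq_LDegree, h2] at h4
        exact absurd h4 (lt_irrefl _)
      · exact h4.2

/-! ### Simultaneous division -/

/-- One remainder serves all the linear forms of a class of the partition which defines the
analytic standard fan: these forms share the set `E` of leading monomials, and a remainder is
determined by the absence of monomials in `E`. -/
theorem exists_common_remainder {n k r : ℕ} (hk : k ≤ n) (m : Fin r → Fin k → ℤ)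
    (N : Submodule (D n) (Fin r → D n)) {L₀ : Fin k → ℚ} (hL₀ : L₀ ∈ nonnegForms k) (e : ℕ) :
    ∃ E : Set (OpIdx n r e × (Fin n →₀ ℕ)),
      (∀ v ∈ boundedPart N e, (∀ b ∈ E, vc v b = 0) → v = 0) ∧
      ∀ f, ∃ g, f - g ∈ boundedPart N e ∧ (∀ b ∈ E, vc g b = 0) ∧
        ∀ L ∈ nonnegForms k, grL hk m (homogModule N) L = grL hk m (homogModule N) L₀ →
          ∀ d : ℝ, (∀ b, vc f b ≠ 0 → d ≤ level hk m L b) →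
            ∀ b, vc g b ≠ 0 → d ≤ level hk m L b := by
  obtain ⟨ψ, σ, hψ, hinj⟩ := exists_injective_wt n (OpIdx n r e)
  have hlog : 0 < Real.log 2 := Real.log_pos (by norm_num)
  have hψ0 : ∀ α, 0 ≤ ψ α := fun α =>
    (by positivity : (0 : ℝ) ≤ Real.log 2 * α.degree).trans (hψ α)
  have hzero : ∀ v ∈ boundedPart N e,
      (∀ b ∈ leadSet (level hk m L₀) (wt ψ σ) (boundedPart N e), vc v b = 0) → v = 0 :=
    fun v hv hE => eq_zero_of_mem_of_leadSet (levelSlope_nonneg hk hL₀) hψ0 hinj hv hE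
  have hdiv : ∀ L ∈ nonnegForms k,
      grL hk m (homogModule N) L = grL hk m (homogModule N) L₀ → ∀ f (d : ℝ),
      (∀ b, vc f b ≠ 0 → d ≤ level hk m L b) → ∃ g, f - g ∈ boundedPart N e ∧
        (∀ b ∈ leadSet (level hk m L₀) (wt ψ σ) (boundedPart N e), vc g b = 0) ∧
        ∀ b, vc g b ≠ 0 → d ≤ level hk m L b := by
    intro L hL hgr f d hf
    obtain ⟨g, hg, hgE, hgd⟩ := exists_remainder (levelSlope_nonneg hk hL) hlog hψ _ σ
      (boundedPart N e) f d hf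
    exact ⟨g, hg, fun b hb => hgE b (leadSet_subset_of_grL_eq hk m N hgr.symm e _ hb), hgd⟩
  refine ⟨leadSet (level hk m L₀) (wt ψ σ) (boundedPart N e), hzero, fun f => ?_⟩
  obtain ⟨d₀, hd₀⟩ : ∃ d₀ : ℝ, ∀ b, vc f b ≠ 0 → d₀ ≤ level hk m L₀ b := by
    by_cases hf : {b | vc f b ≠ 0}.Nonempty
    · obtain ⟨a, -, ha⟩ := exists_forall_wt_le _ (levelSlope_nonneg hk hL₀) _ hf
      exact ⟨_, ha⟩
    · exact ⟨0, fun b hb => absurd ⟨b, hb⟩ hf⟩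
  obtain ⟨g, hg, hgE, -⟩ := hdiv L₀ hL₀ rfl f d₀ hd₀
  refine ⟨g, hg, hgE, fun L hL hgr d hd => ?_⟩
  obtain ⟨g', hg', hgE', hgd'⟩ := hdiv L hL hgr f d hd
  have heq : g' - g = 0 := by
    refine hzero _ ?_ fun b hb => by rw [vc_sub, hgE b hb, hgE' b hb, sub_zero]
    have := sub_mem hg hg'
    rwa [sub_sub_sub_cancel_left] at this
  rw [← sub_eq_zero.mp heq]
  exact hgd'

/-- A closed half-space which contains the members of `K` lying in a basic cone contains the whole
cone, provided that the cone lies in the closure of `K`. -/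
theorem BasicCone.mulVec_nonneg_of_subset_closure {k : ℕ} (Γ : BasicCone k)
    {K : Set (Fin k → ℚ)} (hK : Γ.cone ⊆ closure K) (y : Fin k → ℤ)
    (hy : ∀ L ∈ K, L ∈ Γ.cone → 0 ≤ ∑ i, L i * (y i : ℚ)) (i : Fin k) :
    0 ≤ Γ.form.mulVec y i := by
  classical
  by_contra! hneg
  let F : Matrix (Fin k) (Fin k) ℚ := Γ.form.map (Int.castRingHom ℚ)
  have hF : IsUnit F.det := by
    have : F.det = Int.castRingHom ℚ Γ.form.det := (RingHom.map_det _ _).symm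
    rw [this]
    exact Γ.isUnit_det.map _
  have hFy : F.mulVec (fun j => (y j : ℚ)) = fun i => (Γ.form.mulVec y i : ℚ) := by
    funext i
    simp [F, Matrix.mulVec, dotProduct]
  have hcone : ∀ c : Fin k → ℚ, (∀ i, 0 ≤ c i) → Matrix.vecMul c F ∈ Γ.cone := fun c hc =>
    ⟨c, hc, funext fun j => by simp [F, Matrix.vecMul, dotProduct]⟩
  -- a point of the interior of the cone, close to the `i`-th generator
  set S : ℚ := ∑ j, |(Γ.form.mulVec y j : ℚ)| with hS
  have hS0 : 0 ≤ S := Finset.sum_nonneg fun _ _ => abs_nonneg _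
  let c : Fin k → ℚ := Pi.single i 1 + fun _ => 1 / (1 + S)
  have hc : ∀ j, 0 < c j := fun j => by
    have h1 : (0 : ℚ) ≤ (Pi.single i 1 : Fin k → ℚ) j := by
      rw [Pi.single_apply]
      split_ifs <;> norm_num
    have h2 : (0 : ℚ) < 1 / (1 + S) := by positivity
    exact add_pos_of_nonneg_of_pos h1 h2
  have hcy : (Matrix.vecMul c F) ⬝ᵥ (fun j => (y j : ℚ)) < 0 := by
    rw [← Matrix.dotProduct_mulVec, hFy, add_dotProduct, single_dotProduct, one_mul]
    have h1 : (Γ.form.mulVec y i : ℚ) ≤ -1 := by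
      have : Γ.form.mulVec y i ≤ -1 := by omega
      exact_mod_cast this
    have h2 : (fun _ => 1 / (1 + S)) ⬝ᵥ (fun i => (Γ.form.mulVec y i : ℚ)) ≤ 1 / (1 + S) * S := by
      rw [dotProduct, ← Finset.mul_sum]
      refine mul_le_mul_of_nonneg_left (Finset.sum_le_sum fun j _ => le_abs_self _) (by positivity)
    have h3 : 1 / (1 + S) * S < 1 := by
      rw [one_div, inv_mul_lt_iff₀ (by positivity)]
      linarith
    linarith
  let O : Set (Fin k → ℚ) := {L | (∀ j, 0 < Matrix.vecMul L F⁻¹ j) ∧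
    L ⬝ᵥ (fun j => (y j : ℚ)) < 0}
  have hO : IsOpen O := by
    have hcont : ∀ z : Fin k → ℚ, Continuous fun L : Fin k → ℚ => L ⬝ᵥ z := fun z =>
      continuous_finsetSum _ fun j _ => (continuous_apply j).mul continuous_const
    refine IsOpen.and ?_ (isOpen_lt (hcont _) continuous_const)
    simp only [Set.ofPred_forall]
    exact isOpen_iInter_of_finite fun j => isOpen_lt continuous_const (hcont fun l => F⁻¹ l j)
  obtain ⟨L, hLO, hLK⟩ := mem_closure_iff.mp (hK (hcone c fun j => (hc j).le)) O hO
    ⟨fun j => by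
      rw [Matrix.vecMul_vecMul, Matrix.mul_nonsing_inv _ hF, Matrix.vecMul_one]
      exact hc j, hcy⟩
  have hLΓ : L ∈ Γ.cone := by
    have := hcone _ fun j => (hLO.1 j).le
    rwa [Matrix.vecMul_vecMul, Matrix.nonsing_inv_mul _ hF, Matrix.vecMul_one] at this
  exact absurd (hy L hLK hLΓ) (not_le.mpr hLO.2)

theorem BasicCone.sum_mul_le {k : ℕ} (Γ : BasicCone k) {L : Fin k → ℚ} (hL : L ∈ Γ.cone)
    {y z : Fin k → ℤ} (h : ∀ i, Γ.form.mulVec y i ≤ Γ.form.mulVec z i) :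
    ∑ i, L i * (y i : ℚ) ≤ ∑ i, L i * (z i : ℚ) := by
  obtain ⟨c, hc, rfl⟩ := hL
  have key : ∀ y : Fin k → ℤ, ∑ i, (∑ j, c j * (Γ.form j i : ℚ)) * (y i : ℚ) =
      ∑ j, c j * (Γ.form.mulVec y j : ℚ) := fun y => by
    simp only [Matrix.mulVec, dotProduct, Int.cast_sum, Int.cast_mul, Finset.mul_sum,
      Finset.sum_mul]
    rw [Finset.sum_comm]
    simp only [mul_assoc]
  rw [key, key]
  exact Finset.sum_le_sum fun j _ => mul_le_mul_of_nonneg_left (by exact_mod_cast h j) (hc j)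

/-- Division by the elements of `N` of order at most `e` respects the multifiltration attached to a
cone of the fan. -/
theorem exists_cone_remainder {n k r : ℕ} (hk : k ≤ n) (m : Fin r → Fin k → ℤ)
    (N : Submodule (D n) (Fin r → D n)) (Γ : BasicCone k)
    (hΓ : ∃ C ∈ analyticStandardFan hk m (homogModule N), Γ.cone ⊆ C) (e : ℕ) :
    ∃ E : Set (OpIdx n r e × (Fin n →₀ ℕ)),
      (∀ v ∈ boundedPart N e, (∀ b ∈ E, vc v b = 0) → v = 0) ∧
      ∀ f, ∃ g, f - g ∈ boundedPart N e ∧ (∀ b ∈ E, vc g b = 0) ∧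
        ∀ s : Fin k → ℤ,
          (∀ b, vc f b ≠ 0 → ∀ i, Γ.form.mulVec (multidegree hk m b) i ≤ Γ.form.mulVec s i) →
          ∀ b, vc g b ≠ 0 → ∀ i, Γ.form.mulVec (multidegree hk m b) i ≤ Γ.form.mulVec s i := by
  obtain ⟨_, ⟨L₀, hL₀, rfl⟩, hsub⟩ := hΓ
  obtain ⟨E, hE, hdiv⟩ := exists_common_remainder hk m N hL₀ e
  refine ⟨E, hE, fun f => ?_⟩
  obtain ⟨g, hg, hgE, hgL⟩ := hdiv f
  refine ⟨g, hg, hgE, fun s hs b hb i => ?_⟩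
  have h := Γ.mulVec_nonneg_of_subset_closure hsub (s - multidegree hk m b) (fun L hL hLΓ => ?_) i
  · rw [Matrix.mulVec_sub, Pi.sub_apply] at h
    exact sub_nonneg.mp h
  · have h1 := hgL L hL.1 hL.2 (-((∑ i, L i * (s i : ℚ) : ℚ) : ℝ)) (fun b hb => by
      rw [level_eq_sum, neg_le_neg_iff, Rat.cast_le]
      exact Γ.sum_mul_le hLΓ (hs b hb)) b hb
    rw [level_eq_sum, neg_le_neg_iff, Rat.cast_le] at h1
    simpa [mul_sub, Finset.sum_sub_distrib] using h1

/-! ### The coordinate ring of a basic cone -/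

theorem BasicCone.mem_dual_iff {k : ℕ} (Γ : BasicCone k) {a : Fin k → ℤ} :
    a ∈ Γ.dual ↔ ∀ i, 0 ≤ Γ.form.mulVec a i := by
  constructor
  · intro ha i
    have h : (0 : ℚ) ≤ ∑ j, (Γ.form i j : ℚ) * (a j : ℚ) := ha _ (Γ.form_row_mem i)
    rw [Matrix.mulVec, dotProduct]
    exact_mod_cast h
  · intro ha γ hγ
    have h := Γ.sum_mul_le hγ (y := 0) (z := a) (fun i => by
      rw [Matrix.mulVec_zero]
      exact ha i)
    simpa using h

theorem uPow_add {k : ℕ} (a b : Fin k → ℤ) : uPow (a + b) = uPow a * uPow b := by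
  simp [uPow, AddMonoidAlgebra.single_mul_single]

theorem uPow_zero {k : ℕ} : uPow (0 : Fin k → ℤ) = 1 := rfl

theorem BasicCone.uPow_mem {k : ℕ} (Γ : BasicCone k) {a : Fin k → ℤ} (ha : a ∈ Γ.dual) :
    uPow a ∈ Γ.coordRing :=
  Algebra.subset_adjoin ⟨a, ha, rfl⟩

theorem BasicCone.mulVec_inv_mulVec {k : ℕ} (Γ : BasicCone k) (a : Fin k → ℤ) :
    Γ.form.mulVec (Γ.form⁻¹.mulVec a) = a := by
  rw [Matrix.mulVec_mulVec, Matrix.mul_nonsing_inv _ Γ.isUnit_det, Matrix.one_mulVec]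

theorem BasicCone.inv_mulVec_mulVec {k : ℕ} (Γ : BasicCone k) (a : Fin k → ℤ) :
    Γ.form⁻¹.mulVec (Γ.form.mulVec a) = a := by
  rw [Matrix.mulVec_mulVec, Matrix.nonsing_inv_mul _ Γ.isUnit_det, Matrix.one_mulVec]

/-- The vector `C_j` of the basis dual to `L₁,…,L_k`. -/
def BasicCone.dualBasis {k : ℕ} (Γ : BasicCone k) (j : Fin k) : Fin k → ℤ :=
  Γ.form⁻¹.mulVec (Pi.single j 1)

theorem BasicCone.mulVec_dualBasis {k : ℕ} (Γ : BasicCone k) (i j : Fin k) :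
    Γ.form.mulVec (Γ.dualBasis j) i = if i = j then 1 else 0 := by
  rw [dualBasis, mulVec_inv_mulVec, Pi.single_apply]

theorem BasicCone.dualBasis_mem {k : ℕ} (Γ : BasicCone k) (j : Fin k) :
    Γ.dualBasis j ∈ Γ.dual := by
  rw [mem_dual_iff]
  intro i
  rw [mulVec_dualBasis]
  split_ifs <;> norm_num

/-- The exponent `∑ d_j C_j` of the monomial `W^d`. -/
def BasicCone.exponent {k : ℕ} (Γ : BasicCone k) (d : Fin k →₀ ℕ) : Fin k → ℤ :=
  Γ.form⁻¹.mulVec fun i => (d i : ℤ)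

theorem BasicCone.exponent_injective {k : ℕ} (Γ : BasicCone k) :
    Function.Injective Γ.exponent := by
  intro d d' h
  have h1 := congrArg Γ.form.mulVec h
  rw [exponent, exponent, mulVec_inv_mulVec, mulVec_inv_mulVec] at h1
  exact Finsupp.ext fun i => by exact_mod_cast congrFun h1 i

/-- The morphism `ℂ[W₁,…,W_k] → A_Γ` with `W_j ↦ u^{C_j}`. -/
def BasicCone.ofMvPolynomial {k : ℕ} (Γ : BasicCone k) :
    MvPolynomial (Fin k) ℂ →ₐ[ℂ] Γ.coordRing :=
  MvPolynomial.aeval fun j => ⟨uPow (Γ.dualBasis j), Γ.uPow_mem (Γ.dualBasis_mem j)⟩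

theorem BasicCone.ofMvPolynomial_monomial {k : ℕ} (Γ : BasicCone k) (d : Fin k →₀ ℕ) (c : ℂ) :
    (Γ.ofMvPolynomial (MvPolynomial.monomial d c) : Laurent k) = c • uPow (Γ.exponent d) := by
  have hpow : ∀ (e : ℕ) (a : Fin k → ℤ), uPow a ^ e = uPow (e • a) := by
    intro e a
    induction e with
    | zero => rw [pow_zero, zero_smul, uPow_zero]
    | succ e ih => rw [pow_succ, ih, ← uPow_add, succ_nsmul]
  have hprod : ∀ (s : Finset (Fin k)) (a : Fin k → Fin k → ℤ),
      ∏ i ∈ s, uPow (a i) = uPow (∑ i ∈ s, a i) := by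
    classical
    intro s a
    induction s using Finset.induction_on with
    | empty => rw [Finset.prod_empty, Finset.sum_empty, uPow_zero]
    | insert i s hi ih => rw [Finset.prod_insert hi, Finset.sum_insert hi, ih, uPow_add]
  have hexp : Γ.exponent d = ∑ i, d i • Γ.dualBasis i := by
    have h1 : (fun i => (d i : ℤ)) = ∑ i, d i • (Pi.single i 1 : Fin k → ℤ) := by
      funext j
      simp [Finset.sum_apply, Pi.single_apply]
    rw [exponent, h1, Matrix.mulVec_sum]
    exact Finset.sum_congr rfl fun i _ => by rw [Matrix.mulVec_smul, dualBasis]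
  rw [ofMvPolynomial, MvPolynomial.aeval_monomial, ← Algebra.smul_def,
    Finsupp.prod_fintype _ _ (by simp), hexp, ← hprod]
  push_cast
  simp only [hpow]

theorem BasicCone.coeff_ofMvPolynomial {k : ℕ} (Γ : BasicCone k) (p : MvPolynomial (Fin k) ℂ)
    (d : Fin k →₀ ℕ) :
    (Γ.ofMvPolynomial p : Laurent k).coeff (Γ.exponent d) = MvPolynomial.coeff d p := by
  classical
  induction p using MvPolynomial.induction_on' with
  | monomial e c =>
    rw [ofMvPolynomial_monomial, MvPolynomial.coeff_monomial, uPow,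
      AddMonoidAlgebra.coeff_smul, AddMonoidAlgebra.coeff_single, Finsupp.smul_apply,
      Finsupp.single_apply, smul_eq_mul, mul_ite, mul_one, mul_zero]
    simp only [Γ.exponent_injective.eq_iff]
  | add p q hp hq =>
    rw [map_add, MvPolynomial.coeff_add, ← hp, ← hq]
    rfl

theorem BasicCone.ofMvPolynomial_bijective {k : ℕ} (Γ : BasicCone k) :
    Function.Bijective Γ.ofMvPolynomial := by
  constructor
  · intro p q h
    ext d
    rw [← Γ.coeff_ofMvPolynomial, ← Γ.coeff_ofMvPolynomial, h]
  · rintro ⟨x, hx⟩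
    have hle : Γ.coordRing ≤ (Γ.coordRing.val.comp Γ.ofMvPolynomial).range := by
      refine Algebra.adjoin_le ?_
      rintro _ ⟨a, ha, rfl⟩
      refine ⟨MvPolynomial.monomial
        (Finsupp.equivFunOnFinite.symm fun i => (Γ.form.mulVec a i).toNat) 1, ?_⟩
      change (Γ.ofMvPolynomial _ : Laurent k) = _
      rw [ofMvPolynomial_monomial, one_smul]
      congr 1
      rw [exponent]
      convert Γ.inv_mulVec_mulVec a using 2
      funext i
      exact Int.toNat_of_nonneg (Γ.mem_dual_iff.mp ha i)
    obtain ⟨p, hp⟩ := hle hx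
    exact ⟨p, Subtype.ext hp⟩

/-! ### Flatness criteria -/

/-- A module is flat if each of its finite subsets lies in a flat submodule. -/
theorem flat_of_forall_finset {A X : Type*} [CommRing A] [AddCommGroup X] [Module A X]
    (p : Submodule A X)
    (h : ∀ t : Finset X, (t : Set X) ⊆ p → ∃ q ≤ p, (t : Set X) ⊆ q ∧ Module.Flat A q) :
    Module.Flat A p := by
  classical
  refine Module.Flat.of_forall_isTrivialRelation fun {l f x} hfx => ?_
  obtain ⟨q, hqp, hq, hflat⟩ := h (Finset.univ.image fun i => (x i : X)) (by
    intro z hz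
    obtain ⟨i, -, rfl⟩ := Finset.mem_image.mp hz
    exact (x i).2)
  let y : Fin l → q := fun i => ⟨x i, hq (Finset.mem_image_of_mem _ (Finset.mem_univ i))⟩
  have hfy : ∑ i, f i • y i = 0 := by
    apply Subtype.ext
    have := congrArg Subtype.val hfx
    simpa using this
  obtain ⟨κ, a, z, hz, ha⟩ := Module.Flat.isTrivialRelation_of_sum_smul_eq_zero hfy
  refine ⟨κ, a, fun j => Submodule.inclusion hqp (z j), fun i => ?_, ha⟩
  have : x i = Submodule.inclusion hqp (y i) := rfl
  rw [this, hz i, map_sum]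
  simp only [map_smul]

/-- A module generated by `u^{g c} ⊗ Y c`, for independent subspaces `Y c`, is flat over `A_Γ`:
bases of the `Y c` give an `A_Γ`-basis. -/
theorem flat_span_of_independent {k : ℕ} (Γ : BasicCone k) {M η : Type} [AddCommGroup M]
    [Module ℂ M] [Fintype η] (Y : η → Submodule ℂ M)
    (hY : ∀ y : (c : η) → Y c, ∑ c, (y c : M) = 0 → y = 0) (g : η → Fin k → ℤ) :
    Module.Flat Γ.coordRing (Submodule.span Γ.coordRing
      {z : Laurent k ⊗[ℂ] M | ∃ c, ∃ y ∈ Y c, uPow (g c) ⊗ₜ[ℂ] y = z}) := by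
  classical
  let B := Pi.basis fun c => Module.Basis.ofVectorSpace ℂ (Y c)
  let Ψ : ((c : η) → Y c) →ₗ[ℂ] M := ∑ c, (Y c).subtype ∘ₗ LinearMap.proj c
  have hΨ : ∀ y, Ψ y = ∑ c, (y c : M) := fun y => by simp [Ψ]
  have hb : LinearIndependent ℂ (Ψ ∘ B) := by
    refine B.linearIndependent.map' Ψ (LinearMap.ker_eq_bot'.mpr fun y hy => hY y ?_)
    rw [← hΨ, hy]
  have hΨB : ∀ c i, Ψ (B ⟨c, i⟩) = (Module.Basis.ofVectorSpace ℂ (Y c) i : M) := by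
    intro c i
    rw [hΨ, Pi.basis_apply, Finset.sum_eq_single c]
    · simp
    · intro d _ hd
      simp [Pi.single_eq_of_ne hd]
    · simp
  let w : (Σ c, Module.Basis.ofVectorSpaceIndex ℂ (Y c)) → (Laurent k)ˣ := fun x =>
    ⟨uPow (g x.1), uPow (-g x.1), by rw [← uPow_add, add_neg_cancel, uPow_zero],
      by rw [← uPow_add, neg_add_cancel, uPow_zero]⟩
  have hli := ((Module.Flat.linearIndependent_one_tmul (S := Laurent k) hb).units_smul w)
  have hli' : LinearIndependent Γ.coordRing
      (w • fun x => (1 : Laurent k) ⊗ₜ[ℂ] (Ψ ∘ B) x) := by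
    refine hli.restrict_scalars fun a b hab => Subtype.ext ?_
    simpa [Algebra.smul_def] using hab
  have hv : ∀ x, (w • fun x => (1 : Laurent k) ⊗ₜ[ℂ] (Ψ ∘ B) x) x =
      uPow (g x.1) ⊗ₜ[ℂ] Ψ (B x) := by
    intro x
    change uPow (g x.1) • ((1 : Laurent k) ⊗ₜ[ℂ] Ψ (B x)) = _
    rw [TensorProduct.smul_tmul', smul_eq_mul, mul_one]
  have hspan : Submodule.span Γ.coordRing
      {z : Laurent k ⊗[ℂ] M | ∃ c, ∃ y ∈ Y c, uPow (g c) ⊗ₜ[ℂ] y = z} =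
      Submodule.span Γ.coordRing (Set.range (w • fun x => (1 : Laurent k) ⊗ₜ[ℂ] (Ψ ∘ B) x)) := by
    apply le_antisymm <;> refine Submodule.span_le.mpr ?_
    · rintro _ ⟨c, y, hy, rfl⟩
      suffices h : ∀ y' : Y c, uPow (g c) ⊗ₜ[ℂ] (y' : M) ∈ Submodule.span Γ.coordRing
          (Set.range (w • fun x => (1 : Laurent k) ⊗ₜ[ℂ] (Ψ ∘ B) x)) from h ⟨y, hy⟩
      intro y'
      induction (Module.Basis.ofVectorSpace ℂ (Y c)).mem_span y' using
        Submodule.span_induction with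
      | mem y' hy' =>
        obtain ⟨i, rfl⟩ := hy'
        refine Submodule.subset_span ⟨⟨c, i⟩, ?_⟩
        rw [hv, hΨB]
      | zero => simp
      | add y z _ _ ihy ihz =>
        rw [Submodule.coe_add, TensorProduct.tmul_add]
        exact add_mem ihy ihz
      | smul a y _ ihy =>
        rw [Submodule.coe_smul, TensorProduct.tmul_smul,
          ← algebraMap_smul Γ.coordRing a (uPow (g c) ⊗ₜ[ℂ] (y : M))]
        exact Submodule.smul_mem _ _ ihy
    · rintro _ ⟨⟨c, i⟩, rfl⟩
      refine Submodule.subset_span ⟨c, _, (Module.Basis.ofVectorSpace ℂ (Y c) i).2, ?_⟩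
      rw [hv, hΨB]
  rw [hspan]
  have := Module.Free.of_basis (Module.Basis.span hli')
  infer_instance

/-! ### The multifiltration of a basic cone -/

/-- A convergent series is a finite sum of series, each of which is divisible by a monomial that
occurs in the given one (Dickson's lemma). -/
theorem exists_eq_sum_of_support {n : ℕ} (f : ConvSeries n) :
    ∃ (T : Finset (Fin n →₀ ℕ)) (g : (Fin n →₀ ℕ) → ConvSeries n),
      (∀ t ∈ T, MvPowerSeries.coeff t f.toSeries ≠ 0) ∧ f = ∑ t ∈ T, g t ∧
      ∀ t α, MvPowerSeries.coeff α (g t).toSeries ≠ 0 → t ≤ α := by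
  classical
  obtain ⟨T, hTS, hT⟩ := exists_finset_forall_exists_le
    {α | MvPowerSeries.coeff α f.toSeries ≠ 0}
  have hbase : ∀ α, ∃ t, MvPowerSeries.coeff α f.toSeries ≠ 0 → t ∈ T ∧ t ≤ α := fun α => by
    by_cases h : MvPowerSeries.coeff α f.toSeries ≠ 0
    · obtain ⟨t, ht, hle⟩ := hT α h
      exact ⟨t, fun _ => ⟨ht, hle⟩⟩
    · exact ⟨0, fun h' => absurd h' h⟩
  choose base hbase using hbase
  refine ⟨T, fun t => f.restrict {α | base α = t}, fun t ht => hTS ht,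
    ConvSeries.ext (MvPowerSeries.ext fun α => ?_), fun t α hα => ?_⟩
  · rw [map_sum, map_sum]
    simp only [coeff_restrict, Set.mem_ofPred_eq]
    by_cases h : MvPowerSeries.coeff α f.toSeries = 0
    · simp [h]
    · rw [Finset.sum_eq_single (base α)]
      · rw [if_pos rfl]
      · exact fun t _ ht => if_neg (Ne.symm ht)
      · exact fun h' => absurd (hbase α h).1 h'
  · rw [coeff_restrict] at hα
    split_ifs at hα with h
    · rw [← (show base α = t from h)]
      exact (hbase α hα).2
    · exact absurd rfl hα

/-- The vectors of order at most `e` in the `s`-th step of the multifiltration of `𝒟ʳ` attached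
to a basic cone. -/
def coneStep {n k r : ℕ} (hk : k ≤ n) (m : Fin r → Fin k → ℤ) (Γ : BasicCone k) (e : ℕ)
    (s : Fin k → ℤ) : Submodule ℂ (OpIdx n r e → ConvSeries n) where
  carrier := {v | ∀ b, vc v b ≠ 0 →
    ∀ i, Γ.form.mulVec (multidegree hk m b) i ≤ Γ.form.mulVec s i}
  zero_mem' b hb := absurd (vc_zero b) hb
  add_mem' {v w} hv hw b hb := by
    by_cases h : vc v b = 0
    · exact hw b fun h' => hb (by rw [vc_add, h, h', add_zero])
    · exact hv b h
  smul_mem' c v hv b hb := hv b fun h => hb (by rw [vc_smul, h, mul_zero])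

/-- The class in `𝒟ʳ / N` of the vector of operators with given coefficients. -/
def classOf {n r : ℕ} (N : Submodule (D n) (Fin r → D n)) (e : ℕ) :
    (OpIdx n r e → ConvSeries n) →ₗ[ℂ] (Fin r → D n) ⧸ N :=
  (N.mkQ.restrictScalars ℂ) ∘ₗ ofCoeffs

theorem classOf_eq_zero_iff {n r : ℕ} {N : Submodule (D n) (Fin r → D n)} {e : ℕ}
    {v : OpIdx n r e → ConvSeries n} : classOf N e v = 0 ↔ v ∈ boundedPart N e :=
  Submodule.Quotient.mk_eq_zero N

theorem mem_VFree_iff {n k r : ℕ} {hk : k ≤ n} {m : Fin r → Fin k → ℤ} {s : Fin k → ℤ}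
    {P : Fin r → D n} : P ∈ VFree hk m s ↔ ∀ j i α β, opCoeff (P j) α β ≠ 0 →
      (β (Fin.castLE hk i) : ℤ) - α (Fin.castLE hk i) ≤ s i - m j i := by
  simp only [VFree, Submodule.mem_pi, Set.mem_univ, forall_true_left, V, Submodule.mem_iInf]
  rfl

/-- A vector whose monomials satisfy `Lᵢ(β - α + m⁽ʲ⁾) ≤ Lᵢ(s)` is a finite sum of elements of steps
`V[m]_σ(𝒟ʳ)` with `Lᵢ(σ) ≤ Lᵢ(s)`. -/
theorem classOf_mem_UCone {n k r : ℕ} (hk : k ≤ n) (m : Fin r → Fin k → ℤ)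
    (N : Submodule (D n) (Fin r → D n)) (Γ : BasicCone k) {e : ℕ} {s : Fin k → ℤ}
    {v : OpIdx n r e → ConvSeries n} (hv : v ∈ coneStep hk m Γ e s) :
    classOf N e v ∈ UCone hk m N Γ s := by
  classical
  have : Fintype (OpIdx n r e) := Fintype.ofFinite _
  rw [← Finset.univ_sum_single v, map_sum]
  refine sum_mem fun x _ => ?_
  -- split `v x` into finitely many series, each divisible by one of its own monomials
  obtain ⟨T, g, hT, hsum, hg⟩ := exists_eq_sum_of_support (v x)
  have h1 : (Pi.single x (v x) : OpIdx n r e → ConvSeries n) = ∑ t ∈ T, Pi.single x (g t) := by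
    rw [hsum]
    exact map_sum (AddMonoidHom.single (fun _ : OpIdx n r e => ConvSeries n) x) _ _
  rw [h1, map_sum]
  refine sum_mem fun t ht => ?_
  have hle : ∀ i, Γ.form.mulVec (multidegree hk m (x, t)) i ≤ Γ.form.mulVec s i :=
    hv (x, t) (hT t ht)
  refine le_iSup₂_of_le (f := fun (σ : Fin k → ℤ)
    (_ : ∀ i, Γ.form.mulVec σ i ≤ Γ.form.mulVec s i) => U hk m N σ)
    (multidegree hk m (x, t)) hle le_rfl ?_
  refine ⟨ofCoeffs (Pi.single x (g t)), mem_VFree_iff.mpr fun j i α β h => ?_, rfl⟩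
  have hβ := degree_le_of_opCoeff_ofCoeffs h
  have h2 : vc (Pi.single x (g t) : OpIdx n r e → ConvSeries n) (⟨(j, β), hβ⟩, α) ≠ 0 := by
    rw [← opCoeff_ofCoeffs]
    exact h
  by_cases hx : (⟨(j, β), hβ⟩ : OpIdx n r e) = x
  · subst hx
    simp only [vc, Pi.single_eq_same] at h2
    have h3 : t (Fin.castLE hk i) ≤ α (Fin.castLE hk i) := hg t α h2 _
    simp only [multidegree]
    omega
  · simp [vc, Pi.single_eq_of_ne hx] at h2

/-- For every large `e`, an element of `U^Γ_s(M)` has a representative of order at most `e` all of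
whose monomials satisfy `Lᵢ(β - α + m⁽ʲ⁾) ≤ Lᵢ(s)`. -/
theorem exists_classOf_eq_of_mem_UCone {n k r : ℕ} (hk : k ≤ n) (m : Fin r → Fin k → ℤ)
    (N : Submodule (D n) (Fin r → D n)) (Γ : BasicCone k) {s : Fin k → ℤ}
    {w : (Fin r → D n) ⧸ N} (hw : w ∈ UCone hk m N Γ s) :
    ∃ e₀, ∀ e ≥ e₀, w ∈ (coneStep hk m Γ e s).map (classOf N e) := by
  rw [UCone] at hw
  induction hw using Submodule.iSup_induction' with
  | mem σ w hw =>
    by_cases hσ : ∀ i, Γ.form.mulVec σ i ≤ Γ.form.mulVec s i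
    · rw [iSup_pos hσ] at hw
      obtain ⟨P, hP, rfl⟩ := hw
      refine ⟨Finset.univ.sup fun j => opOrder (P j), fun e he => ?_⟩
      obtain ⟨v, rfl⟩ := exists_ofCoeffs_eq (e := e) fun j =>
        (Finset.le_sup (f := fun j => opOrder (P j)) (Finset.mem_univ j)).trans he
      refine ⟨v, fun b hb i => le_trans ?_ (hσ i), rfl⟩
      change ∑ l, Γ.form i l * multidegree hk m b l ≤ ∑ l, Γ.form i l * σ l
      refine Finset.sum_le_sum fun l _ => mul_le_mul_of_nonneg_left ?_ (Γ.form_nonneg i l)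
      rw [← opCoeff_ofCoeffs] at hb
      have := mem_VFree_iff.mp hP b.1.1.1 l b.2 b.1.1.2 hb
      simp only [multidegree]
      omega
    · rw [iSup_neg hσ, Submodule.mem_bot] at hw
      exact ⟨0, fun e _ => hw ▸ zero_mem _⟩
  | zero => exact ⟨0, fun e _ => zero_mem _⟩
  | add y z _ _ hy hz =>
    obtain ⟨e₁, h₁⟩ := hy
    obtain ⟨e₂, h₂⟩ := hz
    exact ⟨max e₁ e₂, fun e he =>
      add_mem (h₁ e (le_of_max_le_left he)) (h₂ e (le_of_max_le_right he))⟩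

/-! ### Flatness of the Rees module -/

/-- An element of the Rees module involves finitely many degrees and operators of bounded order. -/
theorem exists_bounds_of_mem_reesModule {n k r : ℕ} (hk : k ≤ n) (m : Fin r → Fin k → ℤ)
    (N : Submodule (D n) (Fin r → D n)) (Γ : BasicCone k)
    {z : Laurent k ⊗[ℂ] ((Fin r → D n) ⧸ N)} (hz : z ∈ reesModule hk m N Γ) :
    ∃ (S₀ : Finset (Fin k → ℤ)) (e₀ : ℕ), ∀ S, S₀ ⊆ S → ∀ e ≥ e₀,
      z ∈ ⨆ s ∈ S, uComponent s ((coneStep hk m Γ e s).map (classOf N e)) := by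
  classical
  replace hz : z ∈ ⨆ s, uComponent s (UCone hk m N Γ s) := hz
  induction hz using Submodule.iSup_induction' with
  | mem s z hz =>
    obtain ⟨w, hw, rfl⟩ := hz
    obtain ⟨e₀, h⟩ := exists_classOf_eq_of_mem_UCone hk m N Γ hw
    exact ⟨{s}, e₀, fun S hS e he => Submodule.mem_iSup_of_mem s
      (Submodule.mem_iSup_of_mem (hS (Finset.mem_singleton_self s)) ⟨w, h e he, rfl⟩)⟩
  | zero => exact ⟨∅, 0, fun S _ e _ => zero_mem _⟩
  | add y z _ _ hy hz =>
    obtain ⟨S₁, e₁, h₁⟩ := hy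
    obtain ⟨S₂, e₂, h₂⟩ := hz
    exact ⟨S₁ ∪ S₂, max e₁ e₂, fun S hS e he => add_mem
      (h₁ S (Finset.union_subset_left hS) e (le_of_max_le_left he))
      (h₂ S (Finset.union_subset_right hS) e (le_of_max_le_right he))⟩

/-- The components of finitely many degrees `s ∈ S` and of bounded order generate a submodule of
the Rees module which lies in a flat one. Monomials are sorted according to the set of those
`s ∈ S` whose step of the multifiltration contains them; a nonempty class `c` contributes in the
degree with `L`-coordinates `min_{s ∈ c} Lᵢ(s)`. -/
theorem exists_flat_submodule {n k r : ℕ} (hk : k ≤ n) (m : Fin r → Fin k → ℤ)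
    (N : Submodule (D n) (Fin r → D n)) (Γ : BasicCone k)
    (hΓ : ∃ C ∈ analyticStandardFan hk m (homogModule N), Γ.cone ⊆ C)
    (S : Finset (Fin k → ℤ)) (e : ℕ) :
    ∃ q ≤ reesModule hk m N Γ, Module.Flat Γ.coordRing q ∧
      ∀ z ∈ ⨆ s ∈ S, uComponent s ((coneStep hk m Γ e s).map (classOf N e)), z ∈ q := by
  classical
  obtain ⟨E, hE, hdiv⟩ := exists_cone_remainder hk m N Γ hΓ e
  let cls : OpIdx n r e × (Fin n →₀ ℕ) → Finset (Fin k → ℤ) := fun b =>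
    S.filter fun s => ∀ i, Γ.form.mulVec (multidegree hk m b) i ≤ Γ.form.mulVec s i
  let X : Finset (Fin k → ℤ) → Submodule ℂ (OpIdx n r e → ConvSeries n) := fun c =>
    { carrier := {v | ∀ b, vc v b ≠ 0 → b ∉ E ∧ cls b = c}
      zero_mem' := fun b hb => absurd (vc_zero b) hb
      add_mem' := fun {v w} hv hw b hb => by
        by_cases h : vc v b = 0
        · exact hw b fun h' => hb (by rw [vc_add, h, h', add_zero])
        · exact hv b h
      smul_mem' := fun c v hv b hb => hv b fun h => hb (by rw [vc_smul, h, mul_zero]) }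
  let η : Type := {c // c ∈ S.powerset.filter Finset.Nonempty}
  have hη : ∀ c : η, c.1.Nonempty := fun c => (Finset.mem_filter.mp c.2).2
  let g : η → Fin k → ℤ := fun c =>
    Γ.form⁻¹.mulVec fun i => c.1.inf' (hη c) fun s => Γ.form.mulVec s i
  have hg : ∀ c i, Γ.form.mulVec (g c) i = c.1.inf' (hη c) fun s => Γ.form.mulVec s i :=
    fun c i => by rw [Γ.mulVec_inv_mulVec]
  let Y : η → Submodule ℂ ((Fin r → D n) ⧸ N) := fun c => (X c.1).map (classOf N e)
  -- the supports of the `X c` are disjoint, and `N` contains no nonzero vector supported off `E`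
  have hY : ∀ y : (c : η) → Y c, ∑ c, (y c : (Fin r → D n) ⧸ N) = 0 → y = 0 := by
    intro y hy
    choose v hv hvy using fun c => (y c).2
    have hsum : ∑ c, v c = 0 := by
      refine hE _ (classOf_eq_zero_iff.mp ?_) fun b hb => ?_
      · rw [map_sum, ← hy]
        exact Finset.sum_congr rfl fun c _ => hvy c
      · rw [vc_sum]
        refine Finset.sum_eq_zero fun c _ => ?_
        by_contra h
        exact (hv c b h).1 hb
    have hv0 : ∀ c, v c = 0 := fun c => vc_ext fun b => by
      rw [vc_zero]
      by_contra h
      have h1 : vc (∑ c, v c) b = vc (v c) b := by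
        rw [vc_sum, Finset.sum_eq_single c]
        · intro d _ hdc
          by_contra h'
          exact hdc (Subtype.ext ((hv d b h').2.symm.trans (hv c b h).2))
        · exact fun h' => absurd (Finset.mem_univ c) h'
      rw [hsum, vc_zero] at h1
      exact h h1.symm
    funext c
    apply Subtype.ext
    rw [← hvy c, hv0 c, map_zero]
    rfl
  refine ⟨_, ?_, flat_span_of_independent Γ Y hY g, ?_⟩
  · refine Submodule.span_le.mpr ?_
    rintro _ ⟨c, _, ⟨v, hv, rfl⟩, rfl⟩
    refine Submodule.mem_iSup_of_mem (g c) ⟨_, classOf_mem_UCone hk m N Γ (fun b hb i => ?_), rfl⟩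
    rw [hg, Finset.le_inf'_iff]
    intro s hs
    rw [← (hv b hb).2] at hs
    exact (Finset.mem_filter.mp hs).2 i
  · set q := Submodule.span Γ.coordRing
      {z : Laurent k ⊗[ℂ] ((Fin r → D n) ⧸ N) | ∃ c, ∃ y ∈ Y c, uPow (g c) ⊗ₜ[ℂ] y = z} with hq
    suffices h : (⨆ s ∈ S, uComponent s ((coneStep hk m Γ e s).map (classOf N e))) ≤
        q.restrictScalars ℂ from fun z hz => h hz
    refine iSup₂_le fun s hs => ?_
    rintro _ ⟨_, ⟨f, hf, rfl⟩, rfl⟩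
    obtain ⟨f', hff', hfE, hfs⟩ := hdiv f
    have hfs' : ∀ b, vc f' b ≠ 0 → s ∈ cls b := fun b hb =>
      Finset.mem_filter.mpr ⟨hs, hfs s hf b hb⟩
    have heq : classOf N e f = classOf N e f' := by
      rw [← sub_eq_zero, ← map_sub]
      exact classOf_eq_zero_iff.mpr hff'
    have hsplit : f' = ∑ c ∈ S.powerset.filter (s ∈ ·), vrestrict {b | cls b = c} f' := by
      refine vc_ext fun b => ?_
      rw [vc_sum]
      simp only [vc_vrestrict, Set.mem_ofPred_eq]
      by_cases hb : vc f' b = 0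
      · simp only [hb, ite_self, Finset.sum_const_zero]
      · have hmem : cls b ∈ S.powerset.filter (s ∈ ·) := Finset.mem_filter.mpr
          ⟨Finset.mem_powerset.mpr (Finset.filter_subset _ _), hfs' b hb⟩
        rw [Finset.sum_eq_single (cls b)]
        · rw [if_pos rfl]
        · exact fun c _ hc => if_neg (Ne.symm hc)
        · exact fun h => absurd hmem h
    change uPow s ⊗ₜ[ℂ] classOf N e f ∈ q
    rw [heq, hsplit, map_sum, TensorProduct.tmul_sum]
    refine sum_mem fun c hc => ?_
    obtain ⟨hcS, hsc⟩ := Finset.mem_filter.mp hc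
    let c' : η := ⟨c, Finset.mem_filter.mpr ⟨hcS, s, hsc⟩⟩
    have hdual : s - g c' ∈ Γ.dual := by
      rw [Γ.mem_dual_iff]
      intro i
      rw [Matrix.mulVec_sub, Pi.sub_apply, hg, sub_nonneg]
      exact Finset.inf'_le _ hsc
    have hmem : classOf N e (vrestrict {b | cls b = c} f') ∈ Y c' := by
      refine ⟨_, fun b hb => ?_, rfl⟩
      rw [vc_vrestrict] at hb
      split_ifs at hb with h
      · exact ⟨fun hbE => hb (hfE b hbE), h⟩
      · exact absurd rfl hb
    have h1 := q.smul_mem ⟨uPow (s - g c'), Γ.uPow_mem hdual⟩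
      (Submodule.subset_span ⟨c', _, hmem, rfl⟩)
    have h2 : (⟨uPow (s - g c'), Γ.uPow_mem hdual⟩ : Γ.coordRing) •
        (uPow (g c') ⊗ₜ[ℂ] classOf N e (vrestrict {b | cls b = c} f')) =
        uPow s ⊗ₜ[ℂ] classOf N e (vrestrict {b | cls b = c} f') := by
      change uPow (s - g c') • (uPow (g c') ⊗ₜ[ℂ] _) = _
      rw [TensorProduct.smul_tmul', smul_eq_mul, ← uPow_add, sub_add_cancel]
    rwa [h2] at h1

theorem flat_reesModule {n k r : ℕ} (hk : k ≤ n) (m : Fin r → Fin k → ℤ)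
    (N : Submodule (D n) (Fin r → D n)) (Γ : BasicCone k)
    (hΓ : ∃ C ∈ analyticStandardFan hk m (homogModule N), Γ.cone ⊆ C) :
    Module.Flat Γ.coordRing (reesModule hk m N Γ) := by
  classical
  refine flat_of_forall_finset _ fun t ht => ?_
  obtain ⟨S, e, h⟩ : ∃ (S : Finset (Fin k → ℤ)) (e : ℕ), ∀ z ∈ t,
      z ∈ ⨆ s ∈ S, uComponent s ((coneStep hk m Γ e s).map (classOf N e)) := by
    choose! S₀ e₀ h using fun z (hz : z ∈ t) => exists_bounds_of_mem_reesModule hk m N Γ (ht hz)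
    exact ⟨t.biUnion S₀, t.sup e₀, fun z hz =>
      h z hz _ (Finset.subset_biUnion_of_mem S₀ hz) _ (Finset.le_sup hz)⟩
  obtain ⟨q, hq, hflat, hmem⟩ := exists_flat_submodule hk m N Γ hΓ S e
  exact ⟨q, hq, fun z hz => hmem z (h z hz), hflat⟩

end StdFan

end

theorem mainTheorem1 {n k r : ℕ} (hk1 : 1 ≤ k) (hk : k ≤ n)
    (N : Submodule (StdFan.D n) (Fin r → StdFan.D n))
    (m : Fin r → Fin k → ℤ)
    (Γ : StdFan.BasicCone k)
    (hΓ : ∃ C ∈ StdFan.analyticStandardFan hk m (StdFan.homogModule N), Γ.cone ⊆ C) :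
    (∃ e : MvPolynomial (Fin k) ℂ ≃ₐ[ℂ] Γ.coordRing,
      ∀ j, ∃ c : Fin k → ℤ, (∀ i, Γ.form.mulVec c i = if i = j then 1 else 0) ∧
        (e (MvPolynomial.X j) : StdFan.Laurent k) = StdFan.uPow c) ∧
    Module.Flat Γ.coordRing (StdFan.reesModule hk m N Γ) := by
  refine ⟨⟨AlgEquiv.ofBijective Γ.ofMvPolynomial Γ.ofMvPolynomial_bijective, fun j =>
    ⟨Γ.dualBasis j, fun i => Γ.mulVec_dualBasis i j, ?_⟩⟩, StdFan.flat_reesModule hk m N Γ hΓ⟩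
  rw [AlgEquiv.coe_ofBijective, StdFan.BasicCone.ofMvPolynomial, MvPolynomial.aeval_X]
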